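/- **Setting.** Let $\Omega\subset\mathbb R^2$ be a nonempty bounded open set and $\Omega=\bigcup_{i=1}^N\Omega_i$ with (overlapping) open sets $\Omega_i$. For $x\in\Omega$ let $s(x)=\{i: x\in\Omega_i\}$, let $N_c=\max_x|s(x)|$, and let $0<\tau\le 1/N_c$. Write $a(v,w)=\int_\Omega\nabla v\cdot\nabla w\,dx$, $|v|_1=a(v,v)^{1/2}$, $|v|_{1,\Omega_i}=\|\nabla v\|_{L^2(\Omega_i)}$, $\|\cdot\|_0$ for the norm of $L^2(\Omega)$, $V=H_0^1(\Omega)$, and $V_i=H_0^1(\Omega_i)$, extended by zero to $\Omega$. Let $f\in L^2(\Omega)$, $g\in H^1(\Omega)$, and let $u\in g+V$ be the weak solution of $-\Delta u=f$ in $\Omega$, $u=g$ on $\partial\Omega$. For $z\in g+V$, the local solution for the previous iterate $z$ is the function $\tilde u_i\in z+V_i$ with $a(\tilde u_i,v_i)=\int_\Omega f v_i\,dx$ for all $v_i\in V_i$. *Iterates.* Let $U^{(0)}\in g+V$. Put $u^{(0)}=U^{(0)}$ and $u^{(n+1)}=(1-N\tau)u^{(n)}+\tau\sum_{i=1}^N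 u_i^{(n+1)}$, where $u_i^{(n+1)}$ is the local solution for the previous iterate $u^{(n)}$. Let $U_i(\cdot\,;\theta)$, $i=1,\dots,N$, be parametrized families of functions (the local neural networks), let $\theta_i^{(n+1)}$ be parameters, and put $U^{(n+1)}=(1-N\tau)U^{(n)}+\tau\sum_{i=1}^N U_i^{(n+1)}$, where $U_i^{(n+1)}=U_i(\cdot\,;\theta_i^{(n+1)})$ in $\Omega_i$ and $U_i^{(n+1)}=U^{(n)}$ in $\Omega\setminus\Omega_i$. Assume that the networks $U_i(\cdot\,;\theta_i^{(n+1)})$ belong to $H^1(\Omega_i)$ and that the iterates are conforming: $U^{(n)}\in g+V$ for all $n$. The practical output is $$\widehat U^{(n+1)}(x)=\frac1{|s(x)|}\sum_{i\in s(x)}U_i(x;\theta_i^{(n+1)}),\qquad x\in\Omega.$$ *Assumption 1.* There is a constant $C_0$ such that every $v\in V$ can be written as $v=\sum_{i=1}^N v_i$ with $v_i\in V_i$ and $\sum_{i=1}^N a(v_i,v_i)\le C_0\,a(v,v)$. *Assumption 2.* There is a matrix $\mathcal E=(\mathcal E_{ij})$ with $0\le\mathcal E_{ij}\le1$ such that $a(v_i,v_j)\le\mathcal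 E_{ij}\,a(v_i,v_i)^{1/2}a(v_j,v_j)^{1/2}$ for all $i,j$, $v_i\in V_i$, $v_j\in V_j$. *Assumption 3.* For all $n\ge0$ and all $i$, the local solution $\tilde u_i$ for the previous iterate $U^{(n)}$ satisfies $|\tilde u_i-U_i(\cdot\,;\theta_i^{(n+1)})|_{1,\Omega_i}\le\epsilon/N$. *Constants.* A Poincaré constant is a $C_p\ge0$ with $\|v\|_0\le C_p|v|_1$ for all $v\in V$. An error reduction factor is a $C_1\ge0$ such that $|u-z'|_1\le C_1|u-z|_1$ for all $z\in u+V$, where $z'=(1-N\tau)z+\tau\sum_i\tilde u_i$ with the local solutions $\tilde u_i$ for the previous iterate $z$. **Theorem.** Under Assumptions 1–3, a Poincaré constant exists, the number $\bigl(1-\tfrac{2}{2+C_0}\tau+\|\mathcal E\|_2^2\tau^2\bigr)^{1/2}$ is an error reduction factor, and for every Poincaré constant $C_p$, every error reduction factor $C_1<1$ and every $n\ge0$ one has $\widehat U^{(n+1)}\in L^2(\Omega)$ and $$\|u-\widehat U^{(n+1)}\|_0\le\frac{C_p}{\tau}\Bigl(|u-u^{(n)}|_1+|u-u^{(n+1)}|_1+\frac{2}{1-C_1}\,\epsilon\Bigr).$$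 -/

import Mathlib

open MeasureTheory
open scoped ContDiff RealInnerProductSpace

noncomputable section

namespace Schwarz

/-- The Euclidean plane. -/
abbrev Plane : Type := EuclideanSpace ℝ (Fin 2)

/-- `C_c^∞(Ω)`. -/
def IsTestFunction (Ω : Set Plane) (φ : Plane → ℝ) : Prop :=
  ContDiff ℝ ∞ φ ∧ HasCompactSupport φ ∧ tsupport φ ⊆ Ω

/-- `G` is a weak gradient of `v` on `Ω` (tested in every direction `e`). -/
def HasWeakGrad (Ω : Set Plane) (v : Plane → ℝ) (G : Plane → Plane) : Prop :=
  ∀ φ : Plane → ℝ, IsTestFunction Ω φ → ∀ e : Plane,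
    ∫ x in Ω, v x * fderiv ℝ φ x e = - ∫ x in Ω, φ x * ⟪G x, e⟫

/-- `v ∈ L²(Ω)`. Only the values of `v` on `Ω` matter. -/
def MemL2 (Ω : Set Plane) (v : Plane → ℝ) : Prop :=
  MemLp v 2 (volume.restrict Ω)

/-- `v ∈ H¹(Ω)`. -/
def MemH1 (Ω : Set Plane) (v : Plane → ℝ) : Prop :=
  MemL2 Ω v ∧ ∃ G : Plane → Plane, MemLp G 2 (volume.restrict Ω) ∧ HasWeakGrad Ω v G

open Classical in
/-- The weak gradient of `v ∈ H¹(Ω)`, unique up to null sets when `Ω` is open. -/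
def weakGrad (Ω : Set Plane) (v : Plane → ℝ) : Plane → Plane :=
  if h : ∃ G : Plane → Plane, MemLp G 2 (volume.restrict Ω) ∧ HasWeakGrad Ω v G
  then h.choose else 0

/-- `a(v, w) = ∫_Ω ∇v · ∇w`. -/
def dirichletForm (Ω : Set Plane) (v w : Plane → ℝ) : ℝ :=
  ∫ x in Ω, ⟪weakGrad Ω v x, weakGrad Ω w x⟫

/-- The seminorm `|v|_{1,Ω}`. -/
def h1Seminorm (Ω : Set Plane) (v : Plane → ℝ) : ℝ :=
  Real.sqrt (dirichletForm Ω v v)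

/-- The norm `‖v‖_0` of `L²(Ω)`. -/
def l2Norm (Ω : Set Plane) (v : Plane → ℝ) : ℝ :=
  (eLpNorm v 2 (volume.restrict Ω)).toReal

/-- `v ∈ H_0^1(Ω)`, the closure of `C_c^∞(Ω)` in `H¹(Ω)`. -/
def MemH10 (Ω : Set Plane) (v : Plane → ℝ) : Prop :=
  MemH1 Ω v ∧ ∀ r : ℝ, 0 < r → ∃ φ : Plane → ℝ, IsTestFunction Ω φ ∧
    l2Norm Ω (v - φ) < r ∧ h1Seminorm Ω (v - φ) < r

/-- `v ∈ V_i = H_0^1(Ω_i)`, extended by zero to `Ω`. -/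
def MemLocalSpace (Ω Ωi : Set Plane) (v : Plane → ℝ) : Prop :=
  MemH10 Ωi v ∧ ∀ᵐ x ∂(volume.restrict Ω), x ∉ Ωi → v x = 0

/-- `C` is a constant in the Poincaré inequality on `H_0^1(Ω)`. -/
def IsPoincareConstant (Ω : Set Plane) (C : ℝ) : Prop :=
  0 ≤ C ∧ ∀ v : Plane → ℝ, MemH10 Ω v → l2Norm Ω v ≤ C * h1Seminorm Ω v

/-- `u` is the weak solution of `-Δu = f` in `Ω`, `u = g` on `∂Ω`. -/
def IsWeakSolution (Ω : Set Plane) (f g u : Plane → ℝ) : Prop :=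
  MemH1 Ω u ∧ MemH10 Ω (u - g) ∧
    ∀ v : Plane → ℝ, MemH10 Ω v → dirichletForm Ω u v = ∫ x in Ω, f x * v x

/-- `w` is the weak solution of the local problem `-Δw = f` in `Ω_i`, `w = z` in `Ω ∖ Ω_i`. -/
def IsLocalSolution (Ω Ωi : Set Plane) (f z w : Plane → ℝ) : Prop :=
  MemH1 Ω w ∧ MemLocalSpace Ω Ωi (w - z) ∧
    ∀ v : Plane → ℝ, MemLocalSpace Ω Ωi v → dirichletForm Ω w v = ∫ x in Ω, f x * v x

/-- The open sets `O i` form a decomposition of `Ω` into (possibly overlapping) subdomains. -/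
def IsDecomposition {N : ℕ} (Ω : Set Plane) (O : Fin N → Set Plane) : Prop :=
  (∀ i, IsOpen (O i)) ∧ ⋃ i, O i = Ω

open Classical in
/-- `s(x)`, the indices of the subdomains that contain `x`. -/
def subdomainsAt {N : ℕ} (O : Fin N → Set Plane) (x : Plane) : Finset (Fin N) :=
  Finset.univ.filter fun i => x ∈ O i

/-- `N_c`, the maximum of `|s(x)|`. -/
def maxOverlap {N : ℕ} (O : Fin N → Set Plane) : ℕ :=
  ⨆ x : Plane, (subdomainsAt O x).card

/-- `(1 - N τ) z + τ ∑ i, w i`. -/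
def schwarzUpdate {N : ℕ} (τ : ℝ) (z : Plane → ℝ) (w : Fin N → Plane → ℝ) : Plane → ℝ :=
  fun x => (1 - N * τ) * z x + τ * ∑ i, w i x

/-- `u^{(n)}` is a sequence of additive Schwarz iterates with the local solutions
`u_i^{(n+1)} = uloc n i`, started at `U0`. -/
def IsSchwarzIteration {N : ℕ} (Ω : Set Plane) (O : Fin N → Set Plane) (f : Plane → ℝ) (τ : ℝ)
    (U0 : Plane → ℝ) (un : ℕ → Plane → ℝ) (uloc : ℕ → Fin N → Plane → ℝ) : Prop :=
  un 0 = U0 ∧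
    ∀ n, (∀ i, IsLocalSolution Ω (O i) f (un n) (uloc n i)) ∧
      un (n + 1) = schwarzUpdate τ (un n) (uloc n)

/-- `C` bounds the reduction of the error `|u - z|_1` in one additive Schwarz step, whatever the
previous iterate `z` with the boundary values of `u`. -/
def IsReductionFactor {N : ℕ} (Ω : Set Plane) (O : Fin N → Set Plane) (f u : Plane → ℝ) (τ C : ℝ) :
    Prop :=
  0 ≤ C ∧ ∀ (z : Plane → ℝ) (w : Fin N → Plane → ℝ), MemH10 Ω (u - z) →
    (∀ i, IsLocalSolution Ω (O i) f z (w i)) →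
      h1Seminorm Ω (u - schwarzUpdate τ z w) ≤ C * h1Seminorm Ω (u - z)

/-- Stable decomposition with constant `C0`. -/
def StableDecomposition {N : ℕ} (Ω : Set Plane) (O : Fin N → Set Plane) (C0 : ℝ) : Prop :=
  ∀ v : Plane → ℝ, MemH10 Ω v → ∃ w : Fin N → Plane → ℝ,
    (∀ i, MemLocalSpace Ω (O i) (w i)) ∧
    (∀ᵐ x ∂(volume.restrict Ω), v x = ∑ i, w i x) ∧
    ∑ i, dirichletForm Ω (w i) (w i) ≤ C0 * dirichletForm Ω v v

/-- Strengthened Cauchy-Schwarz inequalities with the matrix `M` of constants in `[0, 1]`. -/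
def StrengthenedCauchySchwarz {N : ℕ} (Ω : Set Plane) (O : Fin N → Set Plane)
    (M : Matrix (Fin N) (Fin N) ℝ) : Prop :=
  ∀ i j, 0 ≤ M i j ∧ M i j ≤ 1 ∧ ∀ v w : Plane → ℝ,
    MemLocalSpace Ω (O i) v → MemLocalSpace Ω (O j) w →
      dirichletForm Ω v w ≤
        M i j * Real.sqrt (dirichletForm Ω v v) * Real.sqrt (dirichletForm Ω w w)

/-- `(1 - 2τ/(2 + C0) + ‖M‖₂² τ²)^{1/2}`, with the spectral norm of `M`. -/
def theoreticalFactor {N : ℕ} (C0 : ℝ) (M : Matrix (Fin N) (Fin N) ℝ) (τ : ℝ) : ℝ :=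
  Real.sqrt (1 - 2 / (2 + C0) * τ + ‖Matrix.toEuclideanCLM (𝕜 := ℝ) M‖ ^ 2 * τ ^ 2)

open Classical in
/-- The function equal to `w` on `Ωi` and to the previous iterate `z` elsewhere. -/
def glue (Ωi : Set Plane) (z w : Plane → ℝ) : Plane → ℝ :=
  fun x => if x ∈ Ωi then w x else z x

/-- The iterates `U^{(n)}`, where `W n i` is the local network function `U_i(·; θ_i^{(n+1)})`. -/
def netIterate {N : ℕ} (O : Fin N → Set Plane) (τ : ℝ) (U0 : Plane → ℝ)
    (W : ℕ → Fin N → Plane → ℝ) : ℕ → Plane → ℝ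
  | 0 => U0
  | n + 1 => schwarzUpdate τ (netIterate O τ U0 W n)
      fun i => glue (O i) (netIterate O τ U0 W n) (W n i)

/-- The average over `i ∈ s(x)` of the local functions `w i`. -/
def localAverage {N : ℕ} (O : Fin N → Set Plane) (w : Fin N → Plane → ℝ) : Plane → ℝ :=
  fun x => (1 / ((subdomainsAt O x).card : ℝ)) * ∑ i ∈ subdomainsAt O x, w i x

/-- Each local function `w i` lies in `H¹(Ω_i)` and approximates the solution of the local
problem with the previous iterate `z` up to `ε / N` in `|·|_{1,Ω_i}`. -/
def LocalApproximation {N : ℕ} (Ω : Set Plane) (O : Fin N → Set Plane) (f : Plane → ℝ) (ε : ℝ)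
    (z : Plane → ℝ) (w : Fin N → Plane → ℝ) : Prop :=
  ∀ i, MemH1 (O i) (w i) ∧ ∃ ut : Plane → ℝ, IsLocalSolution Ω (O i) f z ut ∧
    h1Seminorm (O i) (ut - w i) ≤ ε / N

end Schwarz

end

/-! At `x` only the indices in `s(x)` change the iterate, so `U^{(n+1)} = (1 - τ|s|) U^{(n)} + τ|s|
Û^{(n+1)}`. Solving for the output gives `Û = (1 - c) U^{(n)} + c U^{(n+1)}` with `c = 1/(τ|s|)`,
and `τ ≤ 1/N_c` puts `c` in `[1, 1/τ]`. Hence `‖u - Û‖_0` is at most `1/τ` times the sum of the `L²`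
errors of two consecutive iterates (`localAverage_estimate`), and conformity lets the Poincaré
inequality turn these into `H¹` errors.

It remains to see that `|u^{(n)} - U^{(n)}|_1 ≤ ε/(1 - C₁)`; the triangle inequality, used at `n`
and at `n + 1`, then produces the factor `2`. By linearity a reduction factor also contracts the
distance of two exact steps, so the discrepancy satisfies `d_{n+1} ≤ C₁ d_n + τε` with `d_0 = 0`,
and `τ ≤ 1`.

The delicate point is the term `τε`. One inexact step differs from the exact one by `τ` times a sum
of local errors cut off to the `O i`. The cut-off pieces need not lie in `H¹(Ω)`; only their sum
does, and the boundaries of the `O i` may have positive measure. The gradient of the sum is still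
the glued local gradient (`weakGrad_ae_eq_sum_indicator`), because a weak gradient vanishes a.e. on
the zero set of its function (`HasWeakGrad.ae_eq_zero_of_eq_zero`).

The explicit reduction factor is a Hilbert space computation with the projections of the error onto
the local spaces (`norm_sub_smul_sum_le`). The Poincaré constant comes from the Sobolev inequality
`W^{1,1} ⊂ L²` in the plane. -/

noncomputable section

namespace Schwarz

open Filter Topology Set
open scoped ENNReal

/-! ### Weak derivatives on zero sets, over the whole space. -/

section ZeroSet

variable {E : Type*} [NormedAddCommGroup E] [NormedSpace ℝ E] [FiniteDimensional ℝ E]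
  [MeasurableSpace E] [BorelSpace E] {μ : Measure E} [μ.IsAddHaarMeasure]

/-- Translations act continuously on `L¹`. -/
theorem tendsto_lintegral_translate_sub {g : E → ℝ} (hg : Integrable g μ) :
    Tendsto (fun y => ∫⁻ x, ‖g (x + y) - g x‖ₑ ∂μ) (𝓝 0) (𝓝 0) := by
  let G : Lp ℝ 1 μ := hg.toL1
  let T : E → C(E, E) := fun y => ⟨fun x => x + y, by fun_prop⟩
  have hT : Continuous T := by
    refine ContinuousMap.continuous_of_continuous_uncurry _ ?_
    change Continuous fun p : E × E => p.2 + p.1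
    fun_prop
  have hTm : ∀ y, MeasurePreserving (T y) μ μ := fun y => measurePreserving_add_right μ y
  have key := (Filter.Tendsto.compMeasurePreservingLp (p := 1) (f := fun _ : E => G)
    (tendsto_const_nhds (x := G)) (hT.tendsto 0) hTm (hTm 0) (by simp))
  have h0 : Lp.compMeasurePreserving (T 0) (hTm 0) G = G := by
    refine Lp.ext ?_
    filter_upwards [Lp.coeFn_compMeasurePreserving G (hTm 0)] with x hx
    rw [hx]; simp [T]
  rw [h0, tendsto_iff_edist_tendsto_0] at key
  refine key.congr fun y => ?_
  rw [Lp.edist_def, eLpNorm_one_eq_lintegral_enorm]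
  refine lintegral_congr_ae ?_
  filter_upwards [Lp.coeFn_compMeasurePreserving G (hTm y), hg.coeFn_toL1,
    (hTm y).quasiMeasurePreserving.ae hg.coeFn_toL1] with x h1 h2 h3
  simp only [Pi.sub_apply]
  rw [h1, Function.comp_apply, h2, h3]
  rfl

theorem integrable_translate_prod {g : E → ℝ} (hgm : Measurable g) (hg : Integrable g μ)
    (e : E) {ν : Measure ℝ} [IsFiniteMeasure ν] :
    Integrable (fun p : E × ℝ => g (p.1 + p.2 • e)) (μ.prod ν) := by
  have hm : Measurable fun p : E × ℝ => g (p.1 + p.2 • e) := hgm.comp (by fun_prop)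
  rw [integrable_prod_iff' hm.aestronglyMeasurable]
  refine ⟨Eventually.of_forall fun s => hg.comp_add_right (s • e), ?_⟩
  have : (fun s : ℝ => ∫ x, ‖g (x + s • e)‖ ∂μ) = fun _ => ∫ x, ‖g x‖ ∂μ := by
    ext s
    exact integral_add_right_eq_self (fun x => ‖g x‖) (s • e)
  simp only [this]
  exact integrable_const _

/-- A function with an integrable weak directional derivative `g` is recovered along the direction
from `g` by integration. -/
theorem translate_sub_eq_integral {v g : E → ℝ} (hgm : Measurable g)
    (hv : Integrable v μ) (hg : Integrable g μ) (e : E)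
    (h : ∀ φ : E → ℝ, ContDiff ℝ ∞ φ → HasCompactSupport φ →
      ∫ x, v x * fderiv ℝ φ x e ∂μ = - ∫ x, φ x * g x ∂μ) (t : ℝ) (ht : 0 < t) :
    ∀ᵐ x ∂μ, v (x + t • e) - v x = ∫ s in Ioc 0 t, g (x + s • e) := by
  have hI := integrable_translate_prod (μ := μ) hgm hg e (ν := volume.restrict (Ioc 0 t))
  -- Both sides are tested against `φ`. The translations are moved onto `φ`, where the classical
  -- fundamental theorem of calculus applies, and the hypothesis is used for each translate of `φ`.
  refine ae_eq_of_integral_contDiff_smul_eq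
    ((hv.comp_add_right _).sub hv).locallyIntegrable hI.integral_prod_left.locallyIntegrable ?_
  intro φ hφ hφc
  have hdc : Continuous fun x => fderiv ℝ φ x e :=
    (hφ.continuous_fderiv (by simp)).clm_apply continuous_const
  have hdcc : HasCompactSupport fun x => fderiv ℝ φ x e := hφc.fderiv_apply (𝕜 := ℝ) e
  obtain ⟨C, hC⟩ := hdcc.exists_bound_of_continuous hdc
  obtain ⟨B, hB⟩ := hφc.exists_bound_of_continuous hφ.continuous
  have ftc : ∀ x, φ (x - t • e) - φ x = - ∫ s in Ioc 0 t, fderiv ℝ φ (x - s • e) e := by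
    intro x
    have hd : ∀ s ∈ uIcc 0 t, HasDerivAt (fun s : ℝ => φ (x - s • e))
        (- fderiv ℝ φ (x - s • e) e) s := by
      intro s _
      have h1 : HasDerivAt (fun s : ℝ => x - s • e) (-e) s := by
        simpa using ((hasDerivAt_id s).smul_const e).const_sub x
      have h2 := (hφ.differentiable (by simp) (x - s • e)).hasFDerivAt.comp_hasDerivAt s h1
      exact h2.congr_deriv (by simp)
    have := intervalIntegral.integral_eq_sub_of_hasDerivAt hd
      ((hdc.comp (by fun_prop : Continuous fun s : ℝ => x - s • e)).neg.intervalIntegrable _ _)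
    rw [intervalIntegral.integral_of_le ht.le, integral_neg] at this
    simpa using this.symm
  have hI1 : Integrable (Function.uncurry fun (x : E) (s : ℝ) => v x * fderiv ℝ φ (x - s • e) e)
      (μ.prod (volume.restrict (Ioc 0 t))) := by
    have := (hv.mul_prod (integrable_const (1 : ℝ)) (ν := volume.restrict (Ioc 0 t)))
    simp only [mul_one] at this
    refine this.mul_bdd (c := C) ?_ (Eventually.of_forall fun p => hC _)
    exact (hdc.comp (by fun_prop : Continuous fun p : E × ℝ => p.1 - p.2 • e)).aestronglyMeasurable
  have hI2 : Integrable (Function.uncurry fun (x : E) (s : ℝ) => φ x * g (x + s • e))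
      (μ.prod (volume.restrict (Ioc 0 t))) :=
    hI.bdd_mul (c := B) (hφ.continuous.comp continuous_fst).aestronglyMeasurable
      (Eventually.of_forall fun p => hB _)
  have hvφ : Integrable (fun x => φ x * v x) μ :=
    hv.bdd_mul hφ.continuous.aestronglyMeasurable (Eventually.of_forall hB)
  have hvφ' : Integrable (fun x => φ x * v (x + t • e)) μ :=
    (hv.comp_add_right (t • e)).bdd_mul hφ.continuous.aestronglyMeasurable
      (Eventually.of_forall hB)
  have hvφ'' : Integrable (fun x => φ (x - t • e) * v x) μ :=
    hv.bdd_mul (hφ.continuous.comp (by fun_prop)).aestronglyMeasurable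
      (Eventually.of_forall fun _ => hB _)
  simp only [smul_eq_mul, mul_sub]
  rw [integral_sub hvφ' hvφ]
  have e1 : ∫ x, φ x * v (x + t • e) ∂μ = ∫ x, φ (x - t • e) * v x ∂μ := by
    rw [← integral_add_right_eq_self (fun x => φ (x - t • e) * v x) (t • e)]
    simp
  rw [e1, ← integral_sub hvφ'' hvφ]
  calc ∫ x, (φ (x - t • e) * v x - φ x * v x) ∂μ
      = - ∫ x, (∫ s in Ioc 0 t, v x * fderiv ℝ φ (x - s • e) e) ∂μ := by
        rw [← integral_neg]
        refine integral_congr_ae (Eventually.of_forall fun x => ?_)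
        simp only [integral_const_mul]
        linear_combination v x * ftc x
    _ = - ∫ s in Ioc 0 t, ∫ x, v x * fderiv ℝ φ (x - s • e) e ∂μ := by
        rw [integral_integral_swap hI1]
    _ = ∫ s in Ioc 0 t, ∫ x, φ x * g (x + s • e) ∂μ := by
        rw [← integral_neg]
        congr 1
        ext s
        have hs := h (fun x => φ (x - s • e)) (hφ.comp (contDiff_id.sub contDiff_const))
          (hφc.comp_homeomorph (Homeomorph.subRight (s • e)))
        simp only [fderiv_comp_sub] at hs
        rw [hs, neg_neg, ← integral_add_right_eq_self (fun x => φ (x - s • e) * g x) (s • e)]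
        simp
    _ = ∫ x, (∫ s in Ioc 0 t, φ x * g (x + s • e)) ∂μ := (integral_integral_swap hI2).symm
    _ = ∫ x, (φ x * ∫ s in Ioc 0 t, g (x + s • e)) ∂μ := by
        simp only [integral_const_mul]

/-- Where the integral of `g` along the segment vanishes, `-t g(x)` is the integral of `g(x + s e) -
g(x)` over `0 < s ≤ t`. Tonelli then bounds the `L¹` norm of `g` on `Z` by its translation modulus.
-/
theorem lintegral_diff_quotient_le {g : E → ℝ} (hgm : Measurable g) (e : E)
    (t : ℝ) (ht : 0 < t) (δ : ℝ≥0∞)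
    (hδ : ∀ s ∈ Ioc 0 t, ∫⁻ x, ‖g (x + s • e) - g x‖ₑ ∂μ ≤ δ) (Z : Set E)
    (hZ : MeasurableSet Z)
    (hint : ∀ᵐ x ∂μ, IntegrableOn (fun s : ℝ => g (x + s • e)) (Ioc 0 t))
    (h : ∀ᵐ x ∂μ, x ∈ Z → ∫ s in Ioc 0 t, g (x + s • e) = 0) :
    ∫⁻ x in Z, ‖g x‖ₑ ∂μ ≤ δ := by
  have h1 : ENNReal.ofReal t * ∫⁻ x in Z, ‖g x‖ₑ ∂μ ≤ ENNReal.ofReal t * δ := by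
    calc ENNReal.ofReal t * ∫⁻ x in Z, ‖g x‖ₑ ∂μ
        = ∫⁻ x in Z, ENNReal.ofReal t * ‖g x‖ₑ ∂μ :=
          (lintegral_const_mul _ hgm.enorm).symm
      _ ≤ ∫⁻ x in Z, (∫⁻ s in Ioc 0 t, ‖g (x + s • e) - g x‖ₑ) ∂μ := by
          refine lintegral_mono_ae ?_
          filter_upwards [ae_restrict_of_ae h, ae_restrict_mem hZ, ae_restrict_of_ae hint]
            with x hx hxZ hxi
          refine le_trans (le_of_eq ?_) (enorm_integral_le_lintegral_enorm _)
          rw [integral_sub hxi (integrable_const _), hx hxZ]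
          simp [enorm_mul, Real.enorm_eq_ofReal ht.le, ht.le]
      _ ≤ ∫⁻ x, (∫⁻ s in Ioc 0 t, ‖g (x + s • e) - g x‖ₑ) ∂μ := setLIntegral_le_lintegral _ _
      _ = ∫⁻ s in Ioc 0 t, ∫⁻ x, ‖g (x + s • e) - g x‖ₑ ∂μ := by
          refine lintegral_lintegral_swap (Measurable.aemeasurable ?_)
          exact ((hgm.comp (by fun_prop : Measurable fun p : E × ℝ => p.1 + p.2 • e)).sub
            (hgm.comp measurable_fst)).enorm
      _ ≤ ∫⁻ s in Ioc 0 t, δ := setLIntegral_mono measurable_const hδ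
      _ = ENNReal.ofReal t * δ := by simp [mul_comm]
  exact (ENNReal.mul_le_mul_iff_right (by simpa using ht) ENNReal.ofReal_ne_top).1 h1

/-- A weak directional derivative vanishes almost everywhere on the zero set of the function. -/
theorem weakDeriv_ae_eq_zero_of_eq_zero {v g : E → ℝ} (hv : Integrable v μ)
    (hg : Integrable g μ) (e : E)
    (h : ∀ φ : E → ℝ, ContDiff ℝ ∞ φ → HasCompactSupport φ →
      ∫ x, v x * fderiv ℝ φ x e ∂μ = - ∫ x, φ x * g x ∂μ) :
    ∀ᵐ x ∂μ, v x = 0 → g x = 0 := by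
  -- Genuinely measurable representatives are needed for joint measurability of `g (x + s • e)` in
  -- Tonelli's theorem.
  wlog hm : Measurable v ∧ Measurable g generalizing v g
  · have hv' := hv.aestronglyMeasurable.ae_eq_mk
    have hg' := hg.aestronglyMeasurable.ae_eq_mk
    have := this (hv.congr hv') (hg.congr hg') (fun φ h1 h2 => by
      rw [← integral_congr_ae (hv'.mono fun x hx => congrArg (· * fderiv ℝ φ x e) hx),
        ← integral_congr_ae (hg'.mono fun x hx => congrArg (φ x * ·) hx)]
      exact h φ h1 h2)
      ⟨hv.aestronglyMeasurable.stronglyMeasurable_mk.measurable,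
        hg.aestronglyMeasurable.stronglyMeasurable_mk.measurable⟩
    filter_upwards [this, hv', hg'] with x h1 h2 h3
    rw [h2, h3]; exact h1
  obtain ⟨hvm, hgm⟩ := hm
  set Z : Set E := {x | v x = 0}
  have hZ : MeasurableSet Z := hvm (measurableSet_singleton 0)
  -- The continuity of translations for `k`, and not only for `g`, controls the points of `Z` that
  -- the translation by `t • e` moves out of `Z`.
  let k : E → ℝ := Z.indicator g
  have hk : Integrable k μ := hg.indicator hZ
  have hkm : Measurable k := hgm.indicator hZ
  have hlim : ∀ {w : E → ℝ}, Integrable w μ →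
      Tendsto (fun s : ℝ => ∫⁻ x, ‖w (x + s • e) - w x‖ₑ ∂μ) (𝓝 0) (𝓝 0) := fun hw =>
    (tendsto_lintegral_translate_sub hw).comp
      (by simpa using (by fun_prop : Continuous fun s : ℝ => s • e).tendsto 0)
  have main : ∫⁻ x in Z, ‖g x‖ₑ ∂μ = 0 := by
    refine le_antisymm (ENNReal.le_of_forall_pos_le_add fun δ hδ _ => ?_) bot_le
    rw [zero_add]
    have hδ2 : (0 : ℝ≥0∞) < δ / 2 := by simpa using hδ.ne'
    have ev := ((hlim hg).eventually (Iio_mem_nhds hδ2)).and ((hlim hk).eventually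
      (Iio_mem_nhds hδ2))
    obtain ⟨r, hr, hrs⟩ := Metric.eventually_nhds_iff.1 ev
    have ht : 0 < r / 2 := by positivity
    set t := r / 2
    have hball : ∀ s ∈ Ioc 0 t, dist s 0 < r := fun s hs => by
      rw [Real.dist_eq, sub_zero, abs_of_pos hs.1]
      exact lt_of_le_of_lt hs.2 (half_lt_self hr)
    let Y : Set E := {x | x + t • e ∈ Z}
    have hY : MeasurableSet Y := (measurable_add_const (t • e)) hZ
    -- Both endpoints of the segment are zeros of `v`, so the integral of `g` along it vanishes.
    have b1 : ∫⁻ x in Z ∩ Y, ‖g x‖ₑ ∂μ ≤ δ / 2 := by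
      refine lintegral_diff_quotient_le hgm e t ht _ (fun s hs => (hrs (hball s hs)).1.le)
        (Z ∩ Y) (hZ.inter hY)
        (integrable_translate_prod hgm hg e (ν := volume.restrict (Ioc 0 t))).prod_right_ae ?_
      filter_upwards [translate_sub_eq_integral hgm hv hg e h t ht] with x hx hxZ
      rw [← hx, show v x = 0 from hxZ.1, show v (x + t • e) = 0 from hxZ.2, sub_zero]
    -- Here `k` drops from `g x` to `0` under the translation, so `|g|` is exactly the increment of
    -- `k`.
    have b2 : ∫⁻ x in Z \ Y, ‖g x‖ₑ ∂μ ≤ δ / 2 := by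
      refine le_trans ?_ (hrs (hball t ⟨ht, le_rfl⟩)).2.le
      refine le_trans ?_ (setLIntegral_le_lintegral (Z \ Y) _)
      refine setLIntegral_mono' (hZ.diff hY) fun x hx => ?_
      have h1 : k (x + t • e) = 0 := indicator_of_notMem (s := Z) hx.2 g
      have h2 : k x = g x := indicator_of_mem hx.1 g
      rw [h1, h2, zero_sub, enorm_neg]
    calc ∫⁻ x in Z, ‖g x‖ₑ ∂μ = ∫⁻ x in Z ∩ Y, ‖g x‖ₑ ∂μ + ∫⁻ x in Z \ Y, ‖g x‖ₑ ∂μ :=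
          (lintegral_inter_add_sdiff _ _ hY).symm
      _ ≤ δ / 2 + δ / 2 := add_le_add b1 b2
      _ = δ := ENNReal.add_halves _
  rw [lintegral_eq_zero_iff hgm.enorm, EventuallyEq, ae_restrict_iff' hZ] at main
  filter_upwards [main] with x hx hvx
  simpa using hx hvx

end ZeroSet

/-! ### Pairings of square-integrable functions. -/

theorem abs_integral_inner_le {α F : Type*} [MeasurableSpace α] {μ : Measure α}
    [NormedAddCommGroup F] [InnerProductSpace ℝ F] {f g : α → F} (hf : MemLp f 2 μ)
    (hg : MemLp g 2 μ) :
    |∫ x, ⟪f x, g x⟫ ∂μ| ≤ (eLpNorm f 2 μ).toReal * (eLpNorm g 2 μ).toReal := by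
  have h := abs_real_inner_le_norm (hf.toLp f) (hg.toLp g)
  rw [L2.inner_def, Lp.norm_toLp, Lp.norm_toLp] at h
  refine le_trans (le_of_eq ?_) h
  congr 1
  refine integral_congr_ae ?_
  filter_upwards [hf.coeFn_toLp, hg.coeFn_toLp] with x h1 h2
  rw [h1, h2]

theorem integrable_inner_of_memLp {α F : Type*} [MeasurableSpace α] {μ : Measure α}
    [NormedAddCommGroup F] [InnerProductSpace ℝ F] {f g : α → F} (hf : MemLp f 2 μ)
    (hg : MemLp g 2 μ) : Integrable (fun x => ⟪f x, g x⟫) μ := by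
  refine (L2.integrable_inner (𝕜 := ℝ) (hf.toLp f) (hg.toLp g)).congr ?_
  filter_upwards [hf.coeFn_toLp, hg.coeFn_toLp] with x h1 h2
  rw [h1, h2]

theorem integrable_mul_of_memLp {α : Type*} [MeasurableSpace α] {μ : Measure α} {f g : α → ℝ}
    (hf : MemLp f 2 μ) (hg : MemLp g 2 μ) : Integrable (fun x => f x * g x) μ :=
  hf.integrable_mul hg

variable {Ω Ω' : Set Plane} {v w φ : Plane → ℝ} {G H : Plane → Plane}

theorem inner_gradient (φ : Plane → ℝ) (x e : Plane) : ⟪gradient φ x, e⟫ = fderiv ℝ φ x e := by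
  simp [gradient]

/-! ### Test functions -/

theorem contDiff_memLp (h : ContDiff ℝ ∞ φ) (hc : HasCompactSupport φ) (s : Set Plane) :
    MemLp φ 2 (volume.restrict s) :=
  (h.continuous.memLp_of_hasCompactSupport hc).restrict s

theorem contDiff_memLp_fderiv (h : ContDiff ℝ ∞ φ) (hc : HasCompactSupport φ) (s : Set Plane)
    (e : Plane) : MemLp (fun x => fderiv ℝ φ x e) 2 (volume.restrict s) :=
  (((h.continuous_fderiv (by simp)).clm_apply continuous_const).memLp_of_hasCompactSupport
    (hc.fderiv_apply (𝕜 := ℝ) e)).restrict s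

theorem continuous_gradient (h : ContDiff ℝ ∞ φ) : Continuous (gradient φ) :=
  (InnerProductSpace.toDual ℝ Plane).symm.continuous.comp (h.continuous_fderiv (by simp))

theorem contDiff_memLp_gradient (h : ContDiff ℝ ∞ φ) (hc : HasCompactSupport φ) (s : Set Plane) :
    MemLp (gradient φ) 2 (volume.restrict s) := by
  refine ((continuous_gradient h).memLp_of_hasCompactSupport ?_).restrict s
  exact (hc.fderiv (𝕜 := ℝ)).comp_left (map_zero _)

namespace IsTestFunction

theorem memLp (h : IsTestFunction Ω φ) (s : Set Plane) : MemLp φ 2 (volume.restrict s) :=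
  contDiff_memLp h.1 h.2.1 s

theorem memLp_fderiv (h : IsTestFunction Ω φ) (s : Set Plane) (e : Plane) :
    MemLp (fun x => fderiv ℝ φ x e) 2 (volume.restrict s) :=
  contDiff_memLp_fderiv h.1 h.2.1 s e

theorem mono (h : IsTestFunction Ω' φ) (hs : Ω' ⊆ Ω) : IsTestFunction Ω φ :=
  ⟨h.1, h.2.1, h.2.2.trans hs⟩

theorem eq_zero (h : IsTestFunction Ω φ) {x : Plane} (hx : x ∉ Ω) : φ x = 0 :=
  image_eq_zero_of_notMem_tsupport fun h' => hx (h.2.2 h')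

theorem fderiv_eq_zero (h : IsTestFunction Ω φ) {x : Plane} (hx : x ∉ Ω) : fderiv ℝ φ x = 0 :=
  image_eq_zero_of_notMem_tsupport fun h' => hx (h.2.2 (tsupport_fderiv_subset ℝ h'))

theorem add {ψ : Plane → ℝ} (h : IsTestFunction Ω φ) (h' : IsTestFunction Ω ψ) :
    IsTestFunction Ω (φ + ψ) :=
  ⟨h.1.add h'.1, h.2.1.add h'.2.1,
    (closure_mono (Function.support_add φ ψ)).trans
      (closure_union.subset.trans (union_subset h.2.2 h'.2.2))⟩

theorem const_smul (h : IsTestFunction Ω φ) (c : ℝ) : IsTestFunction Ω (c • φ) :=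
  ⟨h.1.const_smul c, h.2.1.smul_left (f := fun _ => c),
    (closure_mono (Function.support_const_smul_subset c φ)).trans h.2.2⟩

theorem mul_contDiff {ψ : Plane → ℝ} (h : IsTestFunction Ω φ) (h' : ContDiff ℝ ∞ ψ) :
    IsTestFunction Ω (φ * ψ) :=
  ⟨h.1.mul h', h.2.1.mul_right, (tsupport_mul_subset_left).trans h.2.2⟩

end IsTestFunction

/-! ### Weak gradients -/

theorem setIntegral_subset_of_eq_zero {f : Plane → ℝ} (hs : Ω' ⊆ Ω) (h : ∀ x, x ∉ Ω' → f x = 0) :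
    ∫ x in Ω, f x = ∫ x in Ω', f x := by
  rw [setIntegral_eq_integral_of_forall_compl_eq_zero (fun x hx => h x fun h' => hx (hs h')),
    setIntegral_eq_integral_of_forall_compl_eq_zero h]

namespace HasWeakGrad

theorem mono (h : HasWeakGrad Ω v G) (hs : Ω' ⊆ Ω) : HasWeakGrad Ω' v G := by
  intro φ hφ e
  have := h φ (hφ.mono hs) e
  rwa [setIntegral_subset_of_eq_zero hs fun x hx => by simp [hφ.fderiv_eq_zero hx],
    setIntegral_subset_of_eq_zero hs fun x hx => by simp [hφ.eq_zero hx]] at this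

theorem congr_ae (h : HasWeakGrad Ω v G) (hv : v =ᵐ[volume.restrict Ω] w)
    (hG : G =ᵐ[volume.restrict Ω] H) : HasWeakGrad Ω w H := by
  intro φ hφ e
  rw [← integral_congr_ae (hv.mono fun x hx => congrArg (· * fderiv ℝ φ x e) hx),
    ← integral_congr_ae (hG.mono fun x hx => congrArg (φ x * ⟪·, e⟫) hx)]
  exact h φ hφ e

theorem add (hv : MemL2 Ω v) (hw : MemL2 Ω w) (hG : MemLp G 2 (volume.restrict Ω))
    (hH : MemLp H 2 (volume.restrict Ω)) (h : HasWeakGrad Ω v G) (h' : HasWeakGrad Ω w H) :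
    HasWeakGrad Ω (v + w) (G + H) := by
  intro φ hφ e
  simp only [Pi.add_apply, add_mul, inner_add_left, mul_add]
  rw [integral_add (integrable_mul_of_memLp hv (hφ.memLp_fderiv Ω e))
      (integrable_mul_of_memLp hw (hφ.memLp_fderiv Ω e)),
    integral_add (integrable_mul_of_memLp (hφ.memLp Ω) (hG.inner_const e))
      (integrable_mul_of_memLp (hφ.memLp Ω) (hH.inner_const e)), h φ hφ e, h' φ hφ e]
  ring

theorem const_smul (h : HasWeakGrad Ω v G) (c : ℝ) : HasWeakGrad Ω (c • v) (c • G) := by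
  intro φ hφ e
  simp only [Pi.smul_apply, smul_eq_mul, real_inner_smul_left, mul_assoc, mul_left_comm _ c,
    integral_const_mul]
  rw [h φ hφ e]
  ring

theorem ae_unique (hΩ : IsOpen Ω) (hG : MemLp G 2 (volume.restrict Ω))
    (hH : MemLp H 2 (volume.restrict Ω)) (h : HasWeakGrad Ω v G) (h' : HasWeakGrad Ω v H) :
    G =ᵐ[volume.restrict Ω] H := by
  have hGH := hG.sub hH
  have key : ∀ᵐ x, x ∈ Ω → (G - H) x = 0 := by
    refine hΩ.ae_eq_zero_of_integral_contDiff_smul_eq_zero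
      (locallyIntegrableOn_of_locallyIntegrable_restrict
        (hGH.locallyIntegrable (by norm_num))) ?_
    intro φ h1 h2 h3
    have hφ : IsTestFunction Ω φ := ⟨h1, h2, h3⟩
    rw [← setIntegral_eq_integral_of_forall_compl_eq_zero (s := Ω)
      (fun x hx => by rw [hφ.eq_zero hx, zero_smul])]
    have hint : Integrable (fun x => φ x • (G - H) x) (volume.restrict Ω) :=
      memLp_one_iff_integrable.1 (hGH.smul (hφ.memLp Ω))
    refine ext_inner_left ℝ fun e => ?_
    rw [inner_zero_right, ← integral_inner hint e]
    simp only [real_inner_comm _ e, real_inner_smul_left, inner_sub_left, Pi.sub_apply, mul_sub]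
    rw [integral_sub (integrable_mul_of_memLp (hφ.memLp Ω) (hG.inner_const e))
      (integrable_mul_of_memLp (hφ.memLp Ω) (hH.inner_const e)), sub_eq_zero]
    exact neg_injective ((h φ hφ e).symm.trans (h' φ hφ e))
  rw [← ae_restrict_iff' hΩ.measurableSet] at key
  filter_upwards [key] with x hx
  exact sub_eq_zero.1 hx

end HasWeakGrad

/-- No relation between the support of `φ` and `Ω` is required: the test function alone removes the
boundary terms. This allows the roles of `φ` and the test function to be exchanged later. -/
theorem hasWeakGrad_gradient (h : ContDiff ℝ ∞ φ) (hc : HasCompactSupport φ) (Ω : Set Plane) :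
    HasWeakGrad Ω φ (gradient φ) := by
  intro ψ hψ e
  simp only [inner_gradient]
  rw [setIntegral_eq_integral_of_forall_compl_eq_zero
      (fun x hx => by simp [hψ.fderiv_eq_zero hx]),
    setIntegral_eq_integral_of_forall_compl_eq_zero (fun x hx => by simp [hψ.eq_zero hx])]
  have hφ2 := contDiff_memLp h hc univ
  have hφ2' := contDiff_memLp_fderiv h hc univ e
  have hψ2 := hψ.memLp univ
  have hψ2' := hψ.memLp_fderiv univ e
  rw [Measure.restrict_univ] at hφ2 hφ2' hψ2 hψ2'
  rw [integral_mul_fderiv_eq_neg_fderiv_mul_of_integrable (hφ2'.integrable_mul hψ2)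
    (hφ2.integrable_mul hψ2') (hφ2.integrable_mul hψ2)
    (fun x _ => h.differentiable (by simp) x) (fun x _ => hψ.1.differentiable (by simp) x)]
  simp only [mul_comm]

/-- The weak gradient vanishes almost everywhere on the zero set of the function. -/
theorem HasWeakGrad.ae_eq_zero_of_eq_zero (hΩ : IsOpen Ω) (hv : MemL2 Ω v)
    (hG : MemLp G 2 (volume.restrict Ω)) (h : HasWeakGrad Ω v G) :
    ∀ᵐ x ∂(volume.restrict Ω), v x = 0 → G x = 0 := by
  -- Localization: `φ v` vanishes off `Ω` and is integrable on the plane, with derivative `φ ⟪G, e⟫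
  -- + (∂_e φ) v`. On `{v = 0}` the second term drops out.
  have hcomp : ∀ φ, IsTestFunction Ω φ → ∀ e : Plane,
      ∀ᵐ x ∂(volume.restrict Ω), v x = 0 → φ x * ⟪G x, e⟫ = 0 := by
    intro φ hφ e
    have i1 : Integrable (fun x => φ x * v x) := by
      refine (integrableOn_iff_integrable_of_support_subset fun x hx => ?_).1
        (integrable_mul_of_memLp (hφ.memLp Ω) hv)
      by_contra hx'
      simp [hφ.eq_zero hx'] at hx
    have j2 := integrable_mul_of_memLp (hφ.memLp Ω) (hG.inner_const e)
    have j3 := integrable_mul_of_memLp (hφ.memLp_fderiv Ω e) hv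
    have i2 : Integrable (fun x => φ x * ⟪G x, e⟫ + fderiv ℝ φ x e * v x) := by
      refine (integrableOn_iff_integrable_of_support_subset fun x hx => ?_).1 (j2.add j3)
      by_contra hx'
      simp [hφ.eq_zero hx', hφ.fderiv_eq_zero hx'] at hx
    have key := weakDeriv_ae_eq_zero_of_eq_zero i1 i2 e ?_
    · filter_upwards [ae_restrict_of_ae key] with x hx hvx
      simpa [hvx] using hx
    intro ψ hψ hψc
    have hφψ := hφ.mul_contDiff hψ
    obtain ⟨B, hB⟩ := hψc.exists_bound_of_continuous hψ.continuous
    have hd : ∀ x, fderiv ℝ (φ * ψ) x e = φ x * fderiv ℝ ψ x e + fderiv ℝ φ x e * ψ x := by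
      intro x
      rw [fderiv_mul (hφ.1.differentiable (by simp) x) (hψ.differentiable (by simp) x)]
      simp [mul_comm]
    rw [← setIntegral_eq_integral_of_forall_compl_eq_zero (s := Ω)
        (fun x hx => by simp [hφ.eq_zero hx]),
      ← setIntegral_eq_integral_of_forall_compl_eq_zero (s := Ω) (f := fun x => ψ x * _)
        (fun x hx => by simp [hφ.eq_zero hx, hφ.fderiv_eq_zero hx])]
    have hmain := h _ hφψ e
    have k1 : Integrable (fun x => ψ x * (fderiv ℝ φ x e * v x)) (volume.restrict Ω) :=
      j3.bdd_mul hψ.continuous.aestronglyMeasurable (Eventually.of_forall hB)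
    have k2 : Integrable (fun x => ψ x * (φ x * ⟪G x, e⟫)) (volume.restrict Ω) :=
      j2.bdd_mul hψ.continuous.aestronglyMeasurable (Eventually.of_forall hB)
    have k3 := integrable_mul_of_memLp hv (hφψ.memLp_fderiv Ω e)
    calc ∫ x in Ω, φ x * v x * fderiv ℝ ψ x e
        = ∫ x in Ω, (v x * fderiv ℝ (φ * ψ) x e - ψ x * (fderiv ℝ φ x e * v x)) := by
          refine integral_congr_ae (Eventually.of_forall fun x => ?_)
          simp only [hd]
          ring
      _ = -(∫ x in Ω, ψ x * (φ x * ⟪G x, e⟫)) - ∫ x in Ω, ψ x * (fderiv ℝ φ x e * v x) := by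
          rw [integral_sub k3 k1, hmain]
          simp only [Pi.mul_apply, mul_comm, mul_left_comm, mul_assoc]
      _ = -∫ x in Ω, ψ x * (φ x * ⟪G x, e⟫ + fderiv ℝ φ x e * v x) := by
          simp only [mul_add]
          rw [integral_add k2 k1]
          ring
  have hZ : NullMeasurableSet {x | v x = 0} (volume.restrict Ω) :=
    hv.1.aemeasurable.nullMeasurable (measurableSet_singleton 0)
  have hloc : MemLp ({x | v x = 0}.indicator G) 2 (volume.restrict Ω) :=
    hG.of_le (hG.1.indicator₀ hZ) (Eventually.of_forall fun x => norm_indicator_le_norm_self _ _)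
  -- The null set in `hcomp` depends on `φ`. The fundamental lemma of the calculus of variations,
  -- applied to `G` cut off to `{v = 0}`, handles all `φ` without a countable cover.
  have key : ∀ᵐ x, x ∈ Ω → {x | v x = 0}.indicator G x = 0 := by
    refine hΩ.ae_eq_zero_of_integral_contDiff_smul_eq_zero
      (locallyIntegrableOn_of_locallyIntegrable_restrict
        (hloc.locallyIntegrable (by norm_num))) ?_
    intro φ h1 h2 h3
    have hφ : IsTestFunction Ω φ := ⟨h1, h2, h3⟩
    rw [← setIntegral_eq_integral_of_forall_compl_eq_zero (s := Ω)
      (fun x hx => by rw [hφ.eq_zero hx, zero_smul])]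
    refine integral_eq_zero_of_ae ?_
    have hall := ae_all_iff.2 fun i : Fin 2 => hcomp φ hφ (EuclideanSpace.single i 1)
    filter_upwards [hall] with x hx
    by_cases hvx : v x = 0
    · rw [indicator_of_mem (s := {x | v x = 0}) hvx]
      ext i
      simpa [EuclideanSpace.inner_single_right] using hx i hvx
    · rw [indicator_of_notMem (s := {x | v x = 0}) hvx]
      simp
  rw [← ae_restrict_iff' hΩ.measurableSet] at key
  filter_upwards [key] with x hx hvx
  rwa [indicator_of_mem (s := {x | v x = 0}) hvx] at hx

/-! ### The gradient as an element of `L²` -/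

theorem memLp_weakGrad (Ω : Set Plane) (v : Plane → ℝ) :
    MemLp (weakGrad Ω v) 2 (volume.restrict Ω) := by
  unfold weakGrad
  split_ifs with h
  · exact h.choose_spec.1
  · exact MemLp.zero

theorem MemH1.hasWeakGrad (h : MemH1 Ω v) : HasWeakGrad Ω v (weakGrad Ω v) := by
  rw [weakGrad, dif_pos h.2]
  exact h.2.choose_spec.2

theorem MemH1.of_hasWeakGrad (hv : MemL2 Ω v) (hG : MemLp G 2 (volume.restrict Ω))
    (h : HasWeakGrad Ω v G) : MemH1 Ω v :=
  ⟨hv, G, hG, h⟩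

/-- The weak gradient as an element of the Hilbert space `L²(Ω; ℝ²)`. -/
def gradL2 (Ω : Set Plane) (v : Plane → ℝ) : Lp Plane 2 (volume.restrict Ω) :=
  (memLp_weakGrad Ω v).toLp _

theorem dirichletForm_eq_inner (Ω : Set Plane) (v w : Plane → ℝ) :
    dirichletForm Ω v w = ⟪gradL2 Ω v, gradL2 Ω w⟫ := by
  rw [dirichletForm, L2.inner_def]
  refine integral_congr_ae ?_
  filter_upwards [(memLp_weakGrad Ω v).coeFn_toLp, (memLp_weakGrad Ω w).coeFn_toLp] with x h1 h2
  rw [gradL2, gradL2, h1, h2]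

theorem h1Seminorm_eq_norm (Ω : Set Plane) (v : Plane → ℝ) :
    h1Seminorm Ω v = ‖gradL2 Ω v‖ := by
  rw [h1Seminorm, dirichletForm_eq_inner, real_inner_self_eq_norm_sq,
    Real.sqrt_sq (norm_nonneg _)]

/-- Uniqueness of weak gradients on open sets makes the class independent of the choice in
`weakGrad`; every computation of a gradient below passes through this. -/
theorem gradL2_eq_toLp (hΩ : IsOpen Ω) (hG : MemLp G 2 (volume.restrict Ω))
    (h : HasWeakGrad Ω v G) : gradL2 Ω v = hG.toLp G := by
  have hex : ∃ G : Plane → Plane, MemLp G 2 (volume.restrict Ω) ∧ HasWeakGrad Ω v G := ⟨G, hG, h⟩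
  rw [gradL2, MemLp.toLp_eq_toLp_iff]
  refine HasWeakGrad.ae_unique hΩ (memLp_weakGrad Ω v) hG ?_ h
  rw [weakGrad, dif_pos hex]
  exact hex.choose_spec.2

theorem gradL2_congr (h : v =ᵐ[volume.restrict Ω] w) : gradL2 Ω v = gradL2 Ω w := by
  have : HasWeakGrad Ω v = HasWeakGrad Ω w := by
    ext G
    exact ⟨fun hG => hG.congr_ae h .rfl, fun hG => hG.congr_ae h.symm .rfl⟩
  have : weakGrad Ω v = weakGrad Ω w := by
    unfold weakGrad
    rw [this]
  simp only [gradL2, this]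

namespace MemH1

theorem add (hv : MemH1 Ω v) (hw : MemH1 Ω w) : MemH1 Ω (v + w) :=
  .of_hasWeakGrad (MemLp.add hv.1 hw.1) ((memLp_weakGrad Ω v).add (memLp_weakGrad Ω w))
    (HasWeakGrad.add hv.1 hw.1 (memLp_weakGrad Ω v) (memLp_weakGrad Ω w)
      hv.hasWeakGrad hw.hasWeakGrad)

theorem const_smul (hv : MemH1 Ω v) (c : ℝ) : MemH1 Ω (c • v) :=
  .of_hasWeakGrad (MemLp.const_smul hv.1 c) ((memLp_weakGrad Ω v).const_smul c)
    (hv.hasWeakGrad.const_smul c)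

theorem of_contDiff (h : ContDiff ℝ ∞ φ) (hc : HasCompactSupport φ) (Ω : Set Plane) :
    MemH1 Ω φ :=
  .of_hasWeakGrad (contDiff_memLp h hc Ω) (contDiff_memLp_gradient h hc Ω)
    (hasWeakGrad_gradient h hc Ω)

theorem mono (hv : MemH1 Ω v) (hs : Ω' ⊆ Ω) : MemH1 Ω' v :=
  .of_hasWeakGrad (hv.1.mono_measure (Measure.restrict_mono hs le_rfl))
    ((memLp_weakGrad Ω v).mono_measure (Measure.restrict_mono hs le_rfl))
    (hv.hasWeakGrad.mono hs)

end MemH1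

/-- The linear space `H¹(Ω)`. -/
def h1Space (Ω : Set Plane) : Submodule ℝ (Plane → ℝ) where
  carrier := {v | MemH1 Ω v}
  add_mem' := MemH1.add
  zero_mem' := .of_hasWeakGrad (G := 0) MemLp.zero MemLp.zero fun φ _ e => by simp
  smul_mem' c _ hv := hv.const_smul c

theorem MemH1.sub (hv : MemH1 Ω v) (hw : MemH1 Ω w) : MemH1 Ω (v - w) :=
  (h1Space Ω).sub_mem hv hw

theorem gradL2_add (hΩ : IsOpen Ω) (hv : MemH1 Ω v) (hw : MemH1 Ω w) :
    gradL2 Ω (v + w) = gradL2 Ω v + gradL2 Ω w :=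
  gradL2_eq_toLp hΩ ((memLp_weakGrad Ω v).add (memLp_weakGrad Ω w))
    (HasWeakGrad.add hv.1 hw.1 (memLp_weakGrad Ω v) (memLp_weakGrad Ω w)
      hv.hasWeakGrad hw.hasWeakGrad)

theorem gradL2_const_smul (hΩ : IsOpen Ω) (hv : MemH1 Ω v) (c : ℝ) :
    gradL2 Ω (c • v) = c • gradL2 Ω v :=
  gradL2_eq_toLp hΩ ((memLp_weakGrad Ω v).const_smul c) (hv.hasWeakGrad.const_smul c)

/-- The gradient as a linear map on `H¹(Ω)`. -/
def gradMap (hΩ : IsOpen Ω) : h1Space Ω →ₗ[ℝ] Lp Plane 2 (volume.restrict Ω) where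
  toFun v := gradL2 Ω v
  map_add' v w := gradL2_add hΩ v.2 w.2
  map_smul' c v := gradL2_const_smul hΩ v.2 c

theorem gradL2_sub (hΩ : IsOpen Ω) (hv : MemH1 Ω v) (hw : MemH1 Ω w) :
    gradL2 Ω (v - w) = gradL2 Ω v - gradL2 Ω w :=
  (gradMap hΩ).map_sub ⟨v, hv⟩ ⟨w, hw⟩

theorem gradL2_sum (hΩ : IsOpen Ω) {ι : Type*} (s : Finset ι) (f : ι → Plane → ℝ)
    (hf : ∀ i, MemH1 Ω (f i)) : gradL2 Ω (∑ i ∈ s, f i) = ∑ i ∈ s, gradL2 Ω (f i) := by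
  have h := map_sum (gradMap hΩ) (fun i => (⟨f i, hf i⟩ : h1Space Ω)) s
  have h' : gradMap hΩ (∑ i ∈ s, (⟨f i, hf i⟩ : h1Space Ω)) = gradL2 Ω (∑ i ∈ s, f i) := by
    change gradL2 Ω ((∑ i ∈ s, (⟨f i, hf i⟩ : h1Space Ω) : h1Space Ω) : Plane → ℝ) = _
    rw [AddSubmonoidClass.coe_finsetSum]
  rw [← h', h]
  rfl

theorem gradL2_contDiff (hΩ : IsOpen Ω) (h : ContDiff ℝ ∞ φ) (hc : HasCompactSupport φ) :
    gradL2 Ω φ = (contDiff_memLp_gradient h hc Ω).toLp _ :=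
  gradL2_eq_toLp hΩ _ (hasWeakGrad_gradient h hc Ω)

/-! ### The norm of `L²` -/

theorem l2Norm_nonneg (Ω : Set Plane) (v : Plane → ℝ) : 0 ≤ l2Norm Ω v := ENNReal.toReal_nonneg

theorem l2Norm_add_le (hv : MemL2 Ω v) (hw : MemL2 Ω w) :
    l2Norm Ω (v + w) ≤ l2Norm Ω v + l2Norm Ω w := by
  rw [l2Norm, l2Norm, l2Norm, ← ENNReal.toReal_add hv.2.ne hw.2.ne]
  exact ENNReal.toReal_mono (ENNReal.add_ne_top.2 ⟨hv.2.ne, hw.2.ne⟩)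
    (eLpNorm_add_le hv.1 hw.1 (by norm_num))

theorem l2Norm_const_smul (c : ℝ) (v : Plane → ℝ) : l2Norm Ω (c • v) = |c| * l2Norm Ω v := by
  rw [l2Norm, eLpNorm_const_smul, ENNReal.toReal_mul, l2Norm]
  simp

/-! ### The space `H_0^1` -/

namespace MemH10

theorem add (hΩ : IsOpen Ω) (hv : MemH10 Ω v) (hw : MemH10 Ω w) : MemH10 Ω (v + w) := by
  refine ⟨hv.1.add hw.1, fun r hr => ?_⟩
  obtain ⟨φ, hφ, h1, h2⟩ := hv.2 (r / 2) (half_pos hr)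
  obtain ⟨ψ, hψ, h3, h4⟩ := hw.2 (r / 2) (half_pos hr)
  have hφ1 := hv.1.sub (.of_contDiff hφ.1 hφ.2.1 Ω)
  have hψ1 := hw.1.sub (.of_contDiff hψ.1 hψ.2.1 Ω)
  refine ⟨φ + ψ, hφ.add hψ, ?_, ?_⟩
  · rw [add_sub_add_comm]
    linarith [l2Norm_add_le hφ1.1 hψ1.1]
  · rw [h1Seminorm_eq_norm] at *
    rw [add_sub_add_comm, gradL2_add hΩ hφ1 hψ1]
    linarith [norm_add_le (gradL2 Ω (v - φ)) (gradL2 Ω (w - ψ))]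

theorem const_smul (hΩ : IsOpen Ω) (hv : MemH10 Ω v) (c : ℝ) : MemH10 Ω (c • v) := by
  refine ⟨hv.1.const_smul c, fun r hr => ?_⟩
  -- The extra `1` keeps the divisor positive when `c = 0`.
  have hc : 0 < |c| + 1 := by positivity
  obtain ⟨φ, hφ, h1, h2⟩ := hv.2 (r / (|c| + 1)) (by positivity)
  have hφ1 := hv.1.sub (.of_contDiff hφ.1 hφ.2.1 Ω)
  rw [lt_div_iff₀ hc] at h1 h2
  refine ⟨c • φ, hφ.const_smul c, ?_, ?_⟩
  · rw [← smul_sub, l2Norm_const_smul]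
    linarith [l2Norm_nonneg Ω (v - φ)]
  · rw [h1Seminorm_eq_norm] at *
    rw [← smul_sub, gradL2_const_smul hΩ hφ1, norm_smul, Real.norm_eq_abs]
    linarith [norm_nonneg (gradL2 Ω (v - φ))]

theorem of_isTestFunction (hΩ : IsOpen Ω) (hφ : IsTestFunction Ω φ) : MemH10 Ω φ := by
  refine ⟨.of_contDiff hφ.1 hφ.2.1 Ω, fun r hr => ⟨φ, hφ, ?_, ?_⟩⟩
  · simpa [l2Norm] using hr
  · have : gradL2 Ω 0 = 0 := by
      rw [gradL2_eq_toLp hΩ (G := 0) MemLp.zero fun φ _ e => by simp]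
      rfl
    rw [h1Seminorm_eq_norm, sub_self, this, norm_zero]
    exact hr

end MemH10

/-- The linear space `H_0^1(Ω)`. -/
def h10Space (hΩ : IsOpen Ω) : Submodule ℝ (Plane → ℝ) where
  carrier := {v | MemH10 Ω v}
  add_mem' := MemH10.add hΩ
  zero_mem' := .of_isTestFunction hΩ
    ⟨contDiff_const, HasCompactSupport.zero, by simp [tsupport]⟩
  smul_mem' c _ hv := hv.const_smul hΩ c

theorem MemH10.sub (hΩ : IsOpen Ω) (hv : MemH10 Ω v) (hw : MemH10 Ω w) : MemH10 Ω (v - w) :=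
  (h10Space hΩ).sub_mem hv hw

/-- Integration by parts on `Ω` for `v ∈ H_0^1(Ω)` against functions that need not vanish on the
boundary. -/
theorem MemH10.integral_mul_fderiv (hΩ : IsOpen Ω) (hv : MemH10 Ω v) {ψ : Plane → ℝ}
    (hψ : ContDiff ℝ ∞ ψ) (hψc : HasCompactSupport ψ) (e : Plane) :
    ∫ x in Ω, v x * fderiv ℝ ψ x e = - ∫ x in Ω, ψ x * ⟪weakGrad Ω v x, e⟫ := by
  have hψ1 := contDiff_memLp hψ hψc Ω
  have hψ2 := contDiff_memLp_fderiv hψ hψc Ω e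
  have hψe : MemLp (fun x => ψ x • e) 2 (volume.restrict Ω) :=
    MemLp.of_le_mul (c := ‖e‖) hψ1 (hψ1.1.smul_const e)
      (Eventually.of_forall fun x => by rw [norm_smul, mul_comm])
  set A := l2Norm Ω fun x => fderiv ℝ ψ x e
  set B := (eLpNorm (fun x => ψ x • e) 2 (volume.restrict Ω)).toReal
  have hA : 0 ≤ A := ENNReal.toReal_nonneg
  have hB : 0 ≤ B := ENNReal.toReal_nonneg
  rw [← sub_eq_zero, sub_neg_eq_add]
  set D := ∫ x in Ω, v x * fderiv ℝ ψ x e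
  set D' := ∫ x in Ω, ψ x * ⟪weakGrad Ω v x, e⟫
  -- Replacing `v` by an approximating test function `φ` changes the two integrals by at most `r *
  -- A` and `r * B`. For `φ` the identity is classical, with `φ` as the test function and `ψ` as the
  -- function differentiated weakly.
  have main : ∀ r > 0, |D + D'| ≤ r * (A + B) := by
    intro r hr
    obtain ⟨φ, hφ, h1, h2⟩ := hv.2 r hr
    have hφ1 := hφ.memLp Ω
    have hφg := contDiff_memLp_gradient hφ.1 hφ.2.1 Ω
    have hd := hv.1.1.sub hφ1
    have hdg := (memLp_weakGrad Ω v).sub hφg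
    have hgrad : gradL2 Ω (v - φ) = hdg.toLp _ := by
      rw [gradL2_sub hΩ hv.1 (.of_contDiff hφ.1 hφ.2.1 Ω), gradL2_contDiff hΩ hφ.1 hφ.2.1]
      rfl
    have hcl : ∫ x in Ω, φ x * fderiv ℝ ψ x e = - ∫ x in Ω, ψ x * ⟪gradient φ x, e⟫ := by
      have := hasWeakGrad_gradient hψ hψc Ω φ hφ e
      simp only [inner_gradient] at this ⊢
      rw [this, neg_neg]
    have e1 : D = (∫ x in Ω, ⟪(v - φ) x, fderiv ℝ ψ x e⟫) + ∫ x in Ω, φ x * fderiv ℝ ψ x e := by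
      rw [← integral_add (integrable_inner_of_memLp hd hψ2) (integrable_mul_of_memLp hφ1 hψ2)]
      refine integral_congr_ae (Eventually.of_forall fun x => ?_)
      simp only [Pi.sub_apply, RCLike.inner_apply, conj_trivial]
      ring
    have e2 : D' = (∫ x in Ω, ⟪(weakGrad Ω v - gradient φ) x, ψ x • e⟫)
        + ∫ x in Ω, ψ x * ⟪gradient φ x, e⟫ := by
      rw [← integral_add (integrable_inner_of_memLp hdg hψe)
        (integrable_mul_of_memLp hψ1 (hφg.inner_const e))]
      refine integral_congr_ae (Eventually.of_forall fun x => ?_)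
      simp only [Pi.sub_apply, real_inner_smul_right, inner_sub_left]
      ring
    have b1 := abs_integral_inner_le hd hψ2
    have b2 := abs_integral_inner_le hdg hψe
    rw [h1Seminorm_eq_norm, hgrad, Lp.norm_toLp] at h2
    have e3 : D + D' = (∫ x in Ω, ⟪(v - φ) x, fderiv ℝ ψ x e⟫)
        + ∫ x in Ω, ⟪(weakGrad Ω v - gradient φ) x, ψ x • e⟫ := by
      rw [e1, e2, hcl]; ring
    rw [e3]
    have c1 := mul_le_mul_of_nonneg_right h1.le hA
    have c2 := mul_le_mul_of_nonneg_right h2.le hB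
    refine (abs_add_le _ _).trans ?_
    rw [mul_add]
    exact add_le_add (b1.trans c1) (b2.trans c2)
  by_contra hne
  have hpos : 0 < |D + D'| := abs_pos.2 hne
  have := main (|D + D'| / (2 * (A + B + 1))) (by positivity)
  rw [div_mul_eq_mul_div, le_div_iff₀ (by positivity)] at this
  nlinarith

variable {O : Set Plane}

/-! ### Extension by zero -/

theorem eLpNorm_indicator_restrict {F : Type*} [NormedAddCommGroup F] (hO : MeasurableSet O)
    (hs : O ⊆ Ω) (f : Plane → F) :
    eLpNorm (O.indicator f) 2 (volume.restrict Ω) = eLpNorm f 2 (volume.restrict O) := by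
  rw [eLpNorm_indicator_eq_eLpNorm_restrict hO, Measure.restrict_restrict hO,
    inter_eq_left.2 hs]

theorem memLp_indicator_restrict {F : Type*} [NormedAddCommGroup F] (hO : MeasurableSet O)
    (hs : O ⊆ Ω) {f : Plane → F} (hf : MemLp f 2 (volume.restrict O)) :
    MemLp (O.indicator f) 2 (volume.restrict Ω) := by
  rw [memLp_indicator_iff_restrict hO, Measure.restrict_restrict hO, inter_eq_left.2 hs]
  exact hf

namespace MemLocalSpace

theorem ae_eq_indicator (hv : MemLocalSpace Ω O v) :
    v =ᵐ[volume.restrict Ω] O.indicator v := by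
  filter_upwards [hv.2] with x hx
  by_cases h : x ∈ O
  · rw [indicator_of_mem h]
  · rw [indicator_of_notMem h, hx h]

theorem l2Norm_eq (hO : IsOpen O) (hs : O ⊆ Ω) (hv : MemLocalSpace Ω O v) :
    l2Norm Ω v = l2Norm O v := by
  rw [l2Norm, eLpNorm_congr_ae hv.ae_eq_indicator,
    eLpNorm_indicator_restrict hO.measurableSet hs, l2Norm]

theorem memL2 (hO : IsOpen O) (hs : O ⊆ Ω) (hv : MemLocalSpace Ω O v) : MemL2 Ω v :=
  (memLp_congr_ae hv.ae_eq_indicator).2 (memLp_indicator_restrict hO.measurableSet hs hv.1.1.1)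

theorem memLp_indicator_weakGrad (hO : IsOpen O) (hs : O ⊆ Ω) :
    MemLp (O.indicator (weakGrad O v)) 2 (volume.restrict Ω) :=
  memLp_indicator_restrict hO.measurableSet hs (memLp_weakGrad O v)

/-- A test function on `Ω` need not vanish near the boundary of `O`, so the weak gradient on `O`
alone does not suffice; the membership in `H_0^1(O)` enters through `MemH10.integral_mul_fderiv`. -/
theorem hasWeakGrad (hO : IsOpen O) (hs : O ⊆ Ω) (hv : MemLocalSpace Ω O v) :
    HasWeakGrad Ω v (O.indicator (weakGrad O v)) := by
  intro ψ hψ e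
  have key := hv.1.integral_mul_fderiv hO hψ.1 hψ.2.1 e
  have e1 : ∫ x in Ω, v x * fderiv ℝ ψ x e = ∫ x in O, v x * fderiv ℝ ψ x e := by
    rw [← inter_eq_right.2 hs, ← setIntegral_indicator hO.measurableSet]
    refine integral_congr_ae ?_
    filter_upwards [hv.2] with x hx
    by_cases h : x ∈ O
    · rw [indicator_of_mem h]
    · rw [indicator_of_notMem h, hx h, zero_mul]
  have e2 : ∫ x in Ω, ψ x * ⟪O.indicator (weakGrad O v) x, e⟫
      = ∫ x in O, ψ x * ⟪weakGrad O v x, e⟫ := by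
    have h := setIntegral_indicator (μ := volume) (s := Ω) hO.measurableSet
      (f := fun x => ψ x * ⟪weakGrad O v x, e⟫)
    rw [inter_eq_right.2 hs] at h
    rw [← h]
    refine integral_congr_ae (Eventually.of_forall fun x => ?_)
    by_cases h : x ∈ O
    · simp [indicator_of_mem h]
    · simp [indicator_of_notMem h]
  rw [e1, e2, key]

theorem memH1 (hO : IsOpen O) (hs : O ⊆ Ω) (hv : MemLocalSpace Ω O v) : MemH1 Ω v :=
  .of_hasWeakGrad (hv.memL2 hO hs) (memLp_indicator_weakGrad hO hs) (hv.hasWeakGrad hO hs)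

theorem h1Seminorm_eq (hΩ : IsOpen Ω) (hO : IsOpen O) (hs : O ⊆ Ω) (hv : MemLocalSpace Ω O v) :
    h1Seminorm Ω v = h1Seminorm O v := by
  rw [h1Seminorm_eq_norm, h1Seminorm_eq_norm,
    gradL2_eq_toLp hΩ (memLp_indicator_weakGrad hO hs) (hv.hasWeakGrad hO hs), Lp.norm_toLp,
    gradL2, Lp.norm_toLp, eLpNorm_indicator_restrict hO.measurableSet hs]

theorem add (hO : IsOpen O) (hv : MemLocalSpace Ω O v) (hw : MemLocalSpace Ω O w) :
    MemLocalSpace Ω O (v + w) := by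
  refine ⟨hv.1.add hO hw.1, ?_⟩
  filter_upwards [hv.2, hw.2] with x h1 h2 hx
  simp [h1 hx, h2 hx]

theorem const_smul (hO : IsOpen O) (hv : MemLocalSpace Ω O v) (c : ℝ) :
    MemLocalSpace Ω O (c • v) := by
  refine ⟨hv.1.const_smul hO c, ?_⟩
  filter_upwards [hv.2] with x h1 hx
  simp [h1 hx]

theorem sub (hO : IsOpen O) (hv : MemLocalSpace Ω O v) (hw : MemLocalSpace Ω O w) :
    MemLocalSpace Ω O (v - w) := by
  have := hv.add hO (hw.const_smul hO (-1))
  rwa [neg_one_smul, ← sub_eq_add_neg] at this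

theorem of_isTestFunction (hO : IsOpen O) (hφ : IsTestFunction O φ) : MemLocalSpace Ω O φ :=
  ⟨.of_isTestFunction hO hφ, Eventually.of_forall fun _ hx => hφ.eq_zero hx⟩

/-- Extension by zero maps `H_0^1` of a subdomain into `H_0^1` of the domain. -/
theorem memH10 (hΩ : IsOpen Ω) (hO : IsOpen O) (hs : O ⊆ Ω) (hv : MemLocalSpace Ω O v) :
    MemH10 Ω v := by
  refine ⟨hv.memH1 hO hs, fun r hr => ?_⟩
  obtain ⟨φ, hφ, h1, h2⟩ := hv.1.2 r hr
  have hd : MemLocalSpace Ω O (v - φ) := hv.sub hO (.of_isTestFunction hO hφ)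
  exact ⟨φ, hφ.mono hs, (hd.l2Norm_eq hO hs).trans_lt h1,
    (hd.h1Seminorm_eq hΩ hO hs).trans_lt h2⟩

end MemLocalSpace

/-! ### The Poincaré inequality -/

/-- In dimension two the Gagliardo–Nirenberg–Sobolev inequality bounds the `L²` norm by the `L¹`
norm of the gradient. Hölder on the bounded set `Ω` then costs a factor `|Ω|^{1/2}`. -/
theorem exists_l2Norm_le_of_isTestFunction (hΩ : IsOpen Ω) (hb : Bornology.IsBounded Ω) :
    ∃ C : ℝ, 0 ≤ C ∧ ∀ φ, IsTestFunction Ω φ → l2Norm Ω φ ≤ C * h1Seminorm Ω φ := by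
  have hvol : volume Ω ≠ ⊤ := hb.measure_lt_top.ne
  set K : ℝ≥0∞ := (eLpNormLESNormFDerivOneConst (volume : Measure Plane) 2 : ℝ≥0∞)
    * (volume Ω) ^ (1 / 2 : ℝ) with hK
  have hKt : K ≠ ⊤ := ENNReal.mul_ne_top ENNReal.coe_ne_top
    (ENNReal.rpow_ne_top_of_nonneg (by norm_num) hvol)
  refine ⟨K.toReal, ENNReal.toReal_nonneg, fun φ hφ => ?_⟩
  have hfin : Module.finrank ℝ Plane = 2 := by simp
  have h1 := eLpNorm_le_eLpNorm_fderiv_one (volume : Measure Plane) (p := 2)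
    (hφ.1.of_le (by simp)) hφ.2.1 (by rw [hfin]; exact ⟨by norm_num, by norm_num, by norm_num⟩)
  have h2 : eLpNorm (fderiv ℝ φ) 1 volume = eLpNorm (gradient φ) 1 (volume.restrict Ω) := by
    rw [← eLpNorm_restrict_eq_of_support_subset (s := Ω) (f := fderiv ℝ φ)]
    · exact eLpNorm_congr_norm_ae (Eventually.of_forall fun x => by simp [gradient])
    · intro x hx
      by_contra hx'
      exact hx (hφ.fderiv_eq_zero hx')
  have hg := contDiff_memLp_gradient hφ.1 hφ.2.1 Ω
  have h3 := eLpNorm_le_eLpNorm_mul_rpow_measure_univ (p := 1) (q := 2) (by norm_num) hg.1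
  rw [h1Seminorm_eq_norm, gradL2_contDiff hΩ hφ.1 hφ.2.1, Lp.norm_toLp, ← ENNReal.toReal_mul]
  refine ENNReal.toReal_mono (ENNReal.mul_ne_top hKt hg.2.ne) ?_
  calc eLpNorm φ 2 (volume.restrict Ω) ≤ eLpNorm φ 2 volume := eLpNorm_restrict_le _ _ _ _
    _ ≤ _ := h1
    _ ≤ _ := by
      rw [h2]
      refine (mul_le_mul_right h3 _).trans (le_of_eq ?_)
      rw [hK, Measure.restrict_apply_univ]
      norm_num
      ring

theorem exists_isPoincareConstant (hΩ : IsOpen Ω) (hb : Bornology.IsBounded Ω) :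
    ∃ C, IsPoincareConstant Ω C := by
  obtain ⟨C, hC, h⟩ := exists_l2Norm_le_of_isTestFunction hΩ hb
  refine ⟨C, hC, fun v hv => ?_⟩
  refine le_of_forall_pos_le_add fun δ hδ => ?_
  have hC1 : 0 < C + 1 := by positivity
  obtain ⟨φ, hφ, h1, h2⟩ := hv.2 (δ / (C + 1)) (by positivity)
  rw [lt_div_iff₀ hC1] at h1 h2
  have hφ1 : MemH1 Ω φ := .of_contDiff hφ.1 hφ.2.1 Ω
  have h3 := l2Norm_add_le (hv.1.sub hφ1).1 hφ1.1
  rw [sub_add_cancel] at h3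
  have h4 := h φ hφ
  rw [h1Seminorm_eq_norm] at h4 h2 ⊢
  have h5 : ‖gradL2 Ω φ‖ ≤ ‖gradL2 Ω v‖ + ‖gradL2 Ω (v - φ)‖ := by
    rw [gradL2_sub hΩ hv.1 hφ1]
    simpa using norm_sub_le (gradL2 Ω v) (gradL2 Ω v - gradL2 Ω φ)
  have h6 := mul_le_mul_of_nonneg_left h5 hC
  have h7 : 0 ≤ l2Norm Ω (v - φ) := l2Norm_nonneg _ _
  have h8 := norm_nonneg (gradL2 Ω (v - φ))
  rw [← lt_div_iff₀ hC1] at h1 h2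
  have h9 : δ / (C + 1) * (C + 1) = δ := by field_simp
  nlinarith

/-! ### The error reduction factor -/

theorem sum_mul_mul_le_opNorm {N : ℕ} (M : Matrix (Fin N) (Fin N) ℝ) (c : Fin N → ℝ) :
    ∑ i, ∑ j, M i j * c i * c j ≤ ‖Matrix.toEuclideanCLM (𝕜 := ℝ) M‖ * ∑ i, c i ^ 2 := by
  set y : EuclideanSpace ℝ (Fin N) := WithLp.toLp 2 c
  have h1 : ⟪y, Matrix.toEuclideanCLM (𝕜 := ℝ) M y⟫ = ∑ i, ∑ j, M i j * c i * c j := by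
    simp only [PiLp.inner_apply, Matrix.ofLp_toEuclideanCLM, Matrix.mulVec, dotProduct,
      RCLike.inner_apply, conj_trivial, Finset.sum_mul, y]
    refine Finset.sum_congr rfl fun i _ => Finset.sum_congr rfl fun j _ => by ring
  have h2 : ‖y‖ ^ 2 = ∑ i, c i ^ 2 := by
    simp [EuclideanSpace.norm_sq_eq, y]
  rw [← h1, ← h2]
  calc _ ≤ ‖y‖ * ‖Matrix.toEuclideanCLM (𝕜 := ℝ) M y‖ := real_inner_le_norm _ _
    _ ≤ ‖y‖ * (‖Matrix.toEuclideanCLM (𝕜 := ℝ) M‖ * ‖y‖) := by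
        gcongr; exact ContinuousLinearMap.le_opNorm _ _
    _ = _ := by ring

/-- Error reduction of the damped additive Schwarz method in a Hilbert space: `p i` is the
projection of the error `e` onto the `i`-th subspace and `e = ∑ q i` a stable decomposition. -/
theorem norm_sub_smul_sum_le {X : Type*} [NormedAddCommGroup X] [InnerProductSpace ℝ X] {N : ℕ}
    {e : X} {p q : Fin N → X} {M : Matrix (Fin N) (Fin N) ℝ} {τ C0 : ℝ} (hτ : 0 ≤ τ)
    (hp : ∀ i, ⟪p i, p i⟫ = ⟪e, p i⟫) (hq : ∀ i, ⟪p i, q i⟫ = ⟪e, q i⟫) (he : e = ∑ i, q i)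
    (hC0 : ∑ i, ‖q i‖ ^ 2 ≤ C0 * ‖e‖ ^ 2)
    (hM : ∀ i j, ⟪p i, p j⟫ ≤ M i j * ‖p i‖ * ‖p j‖) :
    ‖e - τ • ∑ i, p i‖ ≤
      Real.sqrt (1 - 2 / (2 + C0) * τ + ‖Matrix.toEuclideanCLM (𝕜 := ℝ) M‖ ^ 2 * τ ^ 2) * ‖e‖ := by
  set m := ‖Matrix.toEuclideanCLM (𝕜 := ℝ) M‖
  set T := ∑ i, p i
  set S := ∑ i, ‖p i‖ ^ 2
  have hm : 0 ≤ m := norm_nonneg _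
  have hS : 0 ≤ S := Finset.sum_nonneg fun i _ => sq_nonneg _
  have hTS : ⟪e, T⟫ = S := by
    rw [inner_sum]
    exact Finset.sum_congr rfl fun i _ => by rw [← hp, real_inner_self_eq_norm_sq]
  have hT2 : ‖T‖ ^ 2 ≤ m * S := by
    rw [← real_inner_self_eq_norm_sq, sum_inner]
    simp only [T, inner_sum]
    exact (Finset.sum_le_sum fun i _ => Finset.sum_le_sum fun j _ => hM i j).trans
      (sum_mul_mul_le_opNorm M fun i => ‖p i‖)
  have hSle : S ≤ ‖e‖ * ‖T‖ := hTS ▸ real_inner_le_norm e T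
  -- From `‖T‖² ≤ m S ≤ m ‖e‖ ‖T‖`, after cancelling `‖T‖`.
  have hT : ‖T‖ ≤ m * ‖e‖ := by
    rcases (norm_nonneg T).eq_or_lt with h0 | h0
    · rw [← h0]; positivity
    · nlinarith [mul_le_mul_of_nonneg_left hSle hm]
  rcases (norm_nonneg e).eq_or_lt with h0 | h0
  · have e0 : e = 0 := norm_eq_zero.1 h0.symm
    have T0 : T = 0 := norm_eq_zero.1 (le_antisymm (by simpa [e0] using hT) (norm_nonneg _))
    simp [e0, T0]
  have hee : ‖e‖ ^ 2 ≤ S * C0 := by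
    have h1 : ‖e‖ ^ 2 = ∑ i, ⟪p i, q i⟫ := by
      rw [← real_inner_self_eq_norm_sq]
      nth_rw 2 [he]
      rw [inner_sum]
      exact Finset.sum_congr rfl fun i _ => (hq i).symm
    have h2 : ‖e‖ ^ 2 ≤ ∑ i, ‖p i‖ * ‖q i‖ :=
      h1.trans_le (Finset.sum_le_sum fun i _ => real_inner_le_norm _ _)
    have h3 := Finset.sum_mul_sq_le_sq_mul_sq Finset.univ (fun i => ‖p i‖) fun i => ‖q i‖
    have h4 : (‖e‖ ^ 2) ^ 2 ≤ S * (C0 * ‖e‖ ^ 2) :=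
      (pow_le_pow_left₀ (sq_nonneg _) h2 2).trans (h3.trans (mul_le_mul_of_nonneg_left hC0 hS))
    have : 0 < ‖e‖ ^ 2 := by positivity
    nlinarith
  -- Positivity of `C0` is not assumed; a nonzero error forces it.
  have hC0pos : 0 < C0 := by
    have : 0 < ‖e‖ ^ 2 := by positivity
    by_contra h
    nlinarith
  -- The sharper bound has `C0` in place of `2 + C0`; the stated factor needs only this weaker form.
  have hlow : ‖e‖ ^ 2 / (2 + C0) ≤ S := by
    rw [div_le_iff₀ (by positivity)]
    nlinarith
  have hsq : ‖e - τ • T‖ ^ 2 ≤ (1 - 2 / (2 + C0) * τ + m ^ 2 * τ ^ 2) * ‖e‖ ^ 2 := by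
    have h1 : ‖e - τ • T‖ ^ 2 = ‖e‖ ^ 2 - 2 * τ * S + τ ^ 2 * ‖T‖ ^ 2 := by
      rw [norm_sub_sq_real, real_inner_smul_right, hTS, norm_smul, mul_pow, Real.norm_eq_abs,
        sq_abs]
      ring
    have h2 : ‖T‖ ^ 2 ≤ m ^ 2 * ‖e‖ ^ 2 := by
      rw [← mul_pow]; exact pow_le_pow_left₀ (norm_nonneg _) hT 2
    have h3 := mul_le_mul_of_nonneg_left hlow hτ
    have h4 := mul_le_mul_of_nonneg_left h2 (sq_nonneg τ)
    have h5 : 2 / (2 + C0) * τ * ‖e‖ ^ 2 = 2 * (τ * (‖e‖ ^ 2 / (2 + C0))) := by ring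
    linarith
  calc ‖e - τ • T‖ = Real.sqrt (‖e - τ • T‖ ^ 2) := (Real.sqrt_sq (norm_nonneg _)).symm
    _ ≤ Real.sqrt ((1 - 2 / (2 + C0) * τ + m ^ 2 * τ ^ 2) * ‖e‖ ^ 2) := Real.sqrt_le_sqrt hsq
    _ = _ := by rw [Real.sqrt_mul' _ (sq_nonneg _), Real.sqrt_sq (norm_nonneg _)]

/-- Correction form: the weight `1 - N τ` is absorbed, and the summands `w i - z` lie in the local
spaces when the `w i` are local solutions. -/
theorem schwarzUpdate_eq {N : ℕ} (τ : ℝ) (z : Plane → ℝ) (w : Fin N → Plane → ℝ) :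
    schwarzUpdate τ z w = z + τ • ∑ i, (w i - z) := by
  ext x
  simp only [schwarzUpdate, Pi.add_apply, Pi.sub_apply, Pi.smul_apply, Finset.sum_apply,
    smul_eq_mul]
  rw [Finset.sum_sub_distrib, Finset.sum_const, Finset.card_univ, Fintype.card_fin,
    nsmul_eq_mul]
  ring

theorem IsDecomposition.isOpen {N : ℕ} {O : Fin N → Set Plane} (h : IsDecomposition Ω O)
    (i : Fin N) : IsOpen (O i) := h.1 i

theorem IsDecomposition.subset {N : ℕ} {O : Fin N → Set Plane} (h : IsDecomposition Ω O)
    (i : Fin N) : O i ⊆ Ω := h.2 ▸ subset_iUnion O i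

/-- Galerkin orthogonality of the local solutions. -/
theorem IsLocalSolution.inner_sub_eq {f g u z t : Plane → ℝ} (hΩ : IsOpen Ω) (hO : IsOpen O)
    (hs : O ⊆ Ω) (hu : IsWeakSolution Ω f g u) (hz : MemH1 Ω z) (ht : IsLocalSolution Ω O f z t)
    (hv : MemLocalSpace Ω O v) :
    ⟪gradL2 Ω (t - z), gradL2 Ω v⟫ = ⟪gradL2 Ω (u - z), gradL2 Ω v⟫ := by
  have h := (ht.2.2 v hv).trans (hu.2.2 v (hv.memH10 hΩ hO hs)).symm
  rw [dirichletForm_eq_inner, dirichletForm_eq_inner] at h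
  rw [gradL2_sub hΩ ht.1 hz, gradL2_sub hΩ hu.1 hz, inner_sub_left, inner_sub_left, h]

theorem isReductionFactor_theoreticalFactor {N : ℕ} {O : Fin N → Set Plane} {f g u : Plane → ℝ}
    (hΩ : IsOpen Ω) (hO : IsDecomposition Ω O) (hu : IsWeakSolution Ω f g u) {τ C0 : ℝ}
    (hτ : 0 ≤ τ) (hC0 : StableDecomposition Ω O C0) {M : Matrix (Fin N) (Fin N) ℝ}
    (hM : StrengthenedCauchySchwarz Ω O M) :
    IsReductionFactor Ω O f u τ (theoreticalFactor C0 M τ) := by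
  refine ⟨Real.sqrt_nonneg _, fun z w hz hw => ?_⟩
  have hz1 : MemH1 Ω z := by simpa using hu.1.sub hz.1
  have hp1 : ∀ i, MemH1 Ω (w i - z) := fun i => (hw i).1.sub hz1
  obtain ⟨q, hq, hsum, hqC⟩ := hC0 _ hz
  have hq1 : ∀ i, MemH1 Ω (q i) := fun i => (hq i).memH1 (hO.isOpen i) (hO.subset i)
  have hgal : ∀ i v, MemLocalSpace Ω (O i) v →
      ⟪gradL2 Ω (w i - z), gradL2 Ω v⟫ = ⟪gradL2 Ω (u - z), gradL2 Ω v⟫ := fun i v hv =>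
    (hw i).inner_sub_eq hΩ (hO.isOpen i) (hO.subset i) hu hz1 hv
  have hps : MemH1 Ω (∑ i, (w i - z)) := (h1Space Ω).sum_mem fun i _ => hp1 i
  rw [h1Seminorm_eq_norm, h1Seminorm_eq_norm, schwarzUpdate_eq, ← sub_sub,
    gradL2_sub hΩ hz.1 (hps.const_smul τ), gradL2_const_smul hΩ hps, gradL2_sum hΩ _ _ hp1]
  refine norm_sub_smul_sum_le (q := fun i => gradL2 Ω (q i)) hτ
    (fun i => hgal i _ (hw i).2.1) (fun i => hgal i _ (hq i)) ?_ ?_ fun i j => ?_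
  · rw [← gradL2_sum hΩ _ _ hq1]
    refine gradL2_congr ?_
    filter_upwards [hsum] with x hx
    rw [hx, Finset.sum_apply]
  · simpa only [dirichletForm_eq_inner, real_inner_self_eq_norm_sq] using hqC
  · have := (hM i j).2.2 _ _ (hw i).2.1 (hw j).2.1
    change _ ≤ M i j * h1Seminorm Ω _ * h1Seminorm Ω _ at this
    rwa [h1Seminorm_eq_norm, h1Seminorm_eq_norm, dirichletForm_eq_inner] at this

/-! ### Functions glued from local pieces -/

theorem HasWeakGrad.sum {ι : Type*} (s : Finset ι) {v : ι → Plane → ℝ} {G : ι → Plane → Plane}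
    (hv : ∀ i ∈ s, MemL2 Ω (v i)) (hG : ∀ i ∈ s, MemLp (G i) 2 (volume.restrict Ω))
    (h : ∀ i ∈ s, HasWeakGrad Ω (v i) (G i)) :
    HasWeakGrad Ω (∑ i ∈ s, v i) (∑ i ∈ s, G i) := by
  classical
  induction s using Finset.induction_on with
  | empty => intro φ _ e; simp
  | insert a s ha ih =>
    rw [Finset.sum_insert ha, Finset.sum_insert ha]
    simp only [Finset.forall_mem_insert] at hv hG h
    exact HasWeakGrad.add hv.1 (memLp_finsetSum' s hv.2) hG.1 (memLp_finsetSum' s hG.2) h.1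
      (ih hv.2 hG.2 h.2)

theorem mem_subdomainsAt {N : ℕ} {O : Fin N → Set Plane} {x : Plane} {i : Fin N} :
    i ∈ subdomainsAt O x ↔ x ∈ O i := by
  simp [subdomainsAt]

theorem sum_indicator_eq {N : ℕ} {F : Type*} [AddCommMonoid F] (O : Fin N → Set Plane)
    (d : Fin N → Plane → F) (x : Plane) :
    ∑ i, (O i).indicator (d i) x = ∑ i ∈ subdomainsAt O x, d i x := by
  classical
  rw [← Finset.sum_subset (Finset.subset_univ (subdomainsAt O x))
    fun i _ hi => indicator_of_notMem (fun h => hi (mem_subdomainsAt.2 h)) _]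
  exact Finset.sum_congr rfl fun i hi => indicator_of_mem (mem_subdomainsAt.1 hi) _

/-- The weak gradient of a function glued from pieces `d i ∈ H¹(O i)` is glued from the gradients
of the pieces, even if the boundaries of the `O i` have positive measure. -/
theorem weakGrad_ae_eq_sum_indicator {N : ℕ} {O : Fin N → Set Plane} (hΩ : IsOpen Ω)
    (hO : IsDecomposition Ω O) {E : Plane → ℝ} {d : Fin N → Plane → ℝ} (hE : MemH1 Ω E)
    (hd : ∀ i, MemH1 (O i) (d i))
    (h : ∀ᵐ x ∂(volume.restrict Ω), E x = ∑ i, (O i).indicator (d i) x) :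
    weakGrad Ω E =ᵐ[volume.restrict Ω] ∑ i, (O i).indicator (weakGrad (O i) (d i)) := by
  -- `Ω` is split by the value `A` of `s(x)`. The set `{s(x) = A}` need not be open, but it lies in
  -- the open set `D`, where all `d i` with `i ∈ A` are in `H¹`.
  have key : ∀ A : Finset (Fin N), ∀ᵐ x ∂(volume.restrict Ω), subdomainsAt O x = A →
      weakGrad Ω E x = ∑ i ∈ A, weakGrad (O i) (d i) x := by
    intro A
    let D : Set Plane := Ω ∩ ⋂ i ∈ A, O i
    have hD : IsOpen D := hΩ.inter (isOpen_biInter_finset fun i _ => hO.isOpen i)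
    have hDΩ : D ⊆ Ω := inter_subset_left
    have hDO : ∀ i ∈ A, D ⊆ O i := fun i hi => inter_subset_right.trans (biInter_subset_of_mem hi)
    have hr : ∀ {s : Set Plane}, D ⊆ s → volume.restrict D ≤ volume.restrict s :=
      fun hs => Measure.restrict_mono hs le_rfl
    have m1 : MemL2 D (∑ i ∈ A, d i) :=
      memLp_finsetSum' A fun i hi => ((hd i).1).mono_measure (hr (hDO i hi))
    have m2 : MemLp (∑ i ∈ A, weakGrad (O i) (d i)) 2 (volume.restrict D) :=
      memLp_finsetSum' A fun i hi => (memLp_weakGrad _ _).mono_measure (hr (hDO i hi))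
    have m3 : MemL2 D E := hE.1.mono_measure (hr hDΩ)
    have m4 := (memLp_weakGrad Ω E).mono_measure (hr hDΩ)
    have hw : HasWeakGrad D (∑ i ∈ A, d i) (∑ i ∈ A, weakGrad (O i) (d i)) :=
      .sum A (fun i hi => ((hd i).1).mono_measure (hr (hDO i hi)))
        (fun i hi => (memLp_weakGrad _ _).mono_measure (hr (hDO i hi)))
        fun i hi => (hd i).hasWeakGrad.mono (hDO i hi)
    -- The difference of `E` and the sum of the `d i` over `A` vanishes a.e. on `{s(x) = A}`, hence
    -- so does its gradient.
    have hw' := HasWeakGrad.add m3 (MemLp.const_smul m1 (-1)) m4 (m2.const_smul (-1))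
      (hE.hasWeakGrad.mono hDΩ) (hw.const_smul (-1))
    have hz := hw'.ae_eq_zero_of_eq_zero hD (MemLp.add m3 (MemLp.const_smul m1 (-1)))
      (m4.add (m2.const_smul (-1)))
    rw [ae_restrict_iff' hD.measurableSet] at hz
    filter_upwards [ae_restrict_of_ae hz, h, ae_restrict_mem hΩ.measurableSet]
      with x h1 h2 hxΩ hA
    rw [sum_indicator_eq, hA] at h2
    have hxD : x ∈ D :=
      ⟨hxΩ, mem_iInter₂.2 fun i hi => mem_subdomainsAt.1 (hA ▸ hi)⟩
    have h3 := h1 hxD (by simp [h2])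
    simp only [Pi.add_apply, neg_smul, one_smul, Pi.neg_apply, Finset.sum_apply] at h3
    exact sub_eq_zero.1 ((sub_eq_add_neg _ _).trans h3)
  filter_upwards [ae_all_iff.2 key] with x hx
  rw [Finset.sum_apply, sum_indicator_eq]
  exact hx _ rfl

theorem h1Seminorm_le_sum {N : ℕ} {O : Fin N → Set Plane} (hΩ : IsOpen Ω)
    (hO : IsDecomposition Ω O) {E : Plane → ℝ} {d : Fin N → Plane → ℝ} (hE : MemH1 Ω E)
    (hd : ∀ i, MemH1 (O i) (d i))
    (h : ∀ᵐ x ∂(volume.restrict Ω), E x = ∑ i, (O i).indicator (d i) x) :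
    h1Seminorm Ω E ≤ ∑ i, h1Seminorm (O i) (d i) := by
  have hm : ∀ i, MemLp ((O i).indicator (weakGrad (O i) (d i))) 2 (volume.restrict Ω) :=
    fun i => memLp_indicator_restrict (hO.isOpen i).measurableSet (hO.subset i)
      (memLp_weakGrad _ _)
  rw [h1Seminorm_eq_norm, gradL2, Lp.norm_toLp,
    eLpNorm_congr_ae (weakGrad_ae_eq_sum_indicator hΩ hO hE hd h)]
  simp only [h1Seminorm_eq_norm, gradL2, Lp.norm_toLp]
  rw [← ENNReal.toReal_sum fun i _ => (memLp_weakGrad (O i) (d i)).2.ne]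
  refine ENNReal.toReal_mono
    (ENNReal.sum_ne_top.2 fun i _ => (memLp_weakGrad (O i) (d i)).2.ne) ?_
  refine (eLpNorm_sum_le (fun i _ => (hm i).1) (by norm_num)).trans (le_of_eq ?_)
  exact Finset.sum_congr rfl fun i _ =>
    eLpNorm_indicator_restrict (hO.isOpen i).measurableSet (hO.subset i) _

/-- One inexact step differs from the exact step by at most `τ ε` if the local errors are at most
`ε / N`. -/
theorem exists_local_h1Seminorm_sub_glue_le {N : ℕ} {O : Fin N → Set Plane} (hΩ : IsOpen Ω)
    (hO : IsDecomposition Ω O) (hN : 0 < N) {f z : Plane → ℝ} {W : Fin N → Plane → ℝ} {τ ε : ℝ}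
    (hτ : 0 < τ) (hz : MemH1 Ω z)
    (hz' : MemH1 Ω (schwarzUpdate τ z fun i => glue (O i) z (W i)))
    (h : LocalApproximation Ω O f ε z W) :
    ∃ ut : Fin N → Plane → ℝ, (∀ i, IsLocalSolution Ω (O i) f z (ut i)) ∧
      h1Seminorm Ω (schwarzUpdate τ z ut - schwarzUpdate τ z fun i => glue (O i) z (W i))
        ≤ τ * ε := by
  choose hW ut hut hε using h
  refine ⟨ut, hut, ?_⟩
  have hz'' : MemH1 Ω (schwarzUpdate τ z ut) := by
    rw [schwarzUpdate_eq]
    exact hz.add (((h1Space Ω).sum_mem fun i _ => (hut i).1.sub hz : MemH1 Ω _).const_smul τ)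
  set E := schwarzUpdate τ z ut - schwarzUpdate τ z fun i => glue (O i) z (W i) with hEdef
  have hE : MemH1 Ω E := hz''.sub hz'
  -- The rescaled error is the plain sum of cut-off local errors, the form required by
  -- `h1Seminorm_le_sum`.
  have hEs : E = τ • (τ⁻¹ • E) := by rw [smul_smul, mul_inv_cancel₀ hτ.ne', one_smul]
  rw [h1Seminorm_eq_norm, hEs, gradL2_const_smul hΩ (hE.const_smul _), norm_smul,
    Real.norm_of_nonneg hτ.le, ← h1Seminorm_eq_norm]
  refine mul_le_mul_of_nonneg_left ?_ hτ.le
  have hN' : (N : ℝ) ≠ 0 := by positivity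
  calc h1Seminorm Ω (τ⁻¹ • E) ≤ ∑ i, h1Seminorm (O i) (ut i - W i) := by
        refine h1Seminorm_le_sum hΩ hO (hE.const_smul _)
          (fun i => ((hut i).1.mono (hO.subset i)).sub (hW i)) ?_
        filter_upwards [ae_all_iff.2 fun i => (hut i).2.1.2] with x hx
        simp only [hEdef, schwarzUpdate, Pi.smul_apply, Pi.sub_apply, smul_eq_mul]
        rw [add_sub_add_left_eq_sub, ← mul_sub, inv_mul_cancel_left₀ hτ.ne',
          ← Finset.sum_sub_distrib]
        refine Finset.sum_congr rfl fun i _ => ?_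
        by_cases hi : x ∈ O i
        · simp [glue, hi]
        · simpa [glue, hi] using hx i hi
    _ ≤ ∑ _i : Fin N, ε / N := Finset.sum_le_sum fun i _ => hε i
    _ = ε := by
        rw [Finset.sum_const, Finset.card_univ, Fintype.card_fin, nsmul_eq_mul]
        field_simp

/-- An error reduction factor also bounds the distance of two exact steps. -/
theorem IsReductionFactor.h1Seminorm_update_sub_le {N : ℕ} {O : Fin N → Set Plane}
    {f g u a b : Plane → ℝ} {τ C : ℝ} {p q : Fin N → Plane → ℝ} (hΩ : IsOpen Ω)
    (hO : IsDecomposition Ω O) (hu : IsWeakSolution Ω f g u)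
    (hC : IsReductionFactor Ω O f u τ C) (hab : MemH10 Ω (a - b))
    (hp : ∀ i, IsLocalSolution Ω (O i) f a (p i)) (hq : ∀ i, IsLocalSolution Ω (O i) f b (q i)) :
    h1Seminorm Ω (schwarzUpdate τ a p - schwarzUpdate τ b q) ≤ C * h1Seminorm Ω (a - b) := by
  -- Transport to an error of `u`: with `z = u - (a - b)` the functions `u + (q i - p i)` are local
  -- solutions, since the right-hand sides add up to `f + f - f` and `w i - z = (q i - b) - (p i -
  -- a)`.
  have h := hC.2 (u - (a - b)) (fun i => u + (q i - p i)) (by simpa using hab) fun i => ?_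
  · have e1 : u - schwarzUpdate τ (u - (a - b)) (fun i => u + (q i - p i))
        = schwarzUpdate τ a p - schwarzUpdate τ b q := by
      ext x
      simp only [schwarzUpdate, Pi.sub_apply, Pi.add_apply]
      rw [Finset.sum_add_distrib, Finset.sum_sub_distrib, Finset.sum_const, Finset.card_univ,
        Fintype.card_fin, nsmul_eq_mul]
      ring
    rwa [e1, sub_sub_cancel] at h
  · refine ⟨hu.1.add ((hq i).1.sub (hp i).1), ?_, fun v hv => ?_⟩
    · have := (hq i).2.1.sub (hO.isOpen i) (hp i).2.1
      convert! this using 1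
      abel
    · have h1 := hu.2.2 v (hv.memH10 hΩ (hO.isOpen i) (hO.subset i))
      have h2 := (hp i).2.2 v hv
      have h3 := (hq i).2.2 v hv
      rw [dirichletForm_eq_inner] at h1 h2 h3 ⊢
      rw [gradL2_add hΩ hu.1 ((hq i).1.sub (hp i).1), gradL2_sub hΩ (hq i).1 (hp i).1,
        inner_add_left, inner_sub_left, h1, h2, h3]
      ring

/-! ### Boundary values of the exact iterates. -/

theorem schwarzUpdate_sub_memH10 {N : ℕ} {O : Fin N → Set Plane} (hΩ : IsOpen Ω)
    (hO : IsDecomposition Ω O) {f z : Plane → ℝ} {p : Fin N → Plane → ℝ} (τ : ℝ)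
    (hp : ∀ i, IsLocalSolution Ω (O i) f z (p i)) :
    MemH10 Ω (schwarzUpdate τ z p - z) := by
  rw [schwarzUpdate_eq, add_sub_cancel_left]
  exact MemH10.const_smul hΩ ((h10Space hΩ).sum_mem fun i _ =>
    (hp i).2.1.memH10 hΩ (hO.isOpen i) (hO.subset i)) τ

theorem IsSchwarzIteration.sub_memH10 {N : ℕ} {O : Fin N → Set Plane} (hΩ : IsOpen Ω)
    (hO : IsDecomposition Ω O) {f g U0 : Plane → ℝ} {τ : ℝ} {un : ℕ → Plane → ℝ}
    {uloc : ℕ → Fin N → Plane → ℝ} (h : IsSchwarzIteration Ω O f τ U0 un uloc)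
    (h0 : MemH10 Ω (U0 - g)) (n : ℕ) : MemH10 Ω (un n - g) := by
  induction n with
  | zero => rwa [h.1]
  | succ n ih =>
    have := (schwarzUpdate_sub_memH10 hΩ hO τ (h.2 n).1).add hΩ ih
    rwa [sub_add_sub_cancel, ← (h.2 n).2] at this

/-! ### The practical output -/

theorem card_subdomainsAt_le {N : ℕ} (O : Fin N → Set Plane) (x : Plane) :
    (subdomainsAt O x).card ≤ maxOverlap O :=
  le_ciSup (f := fun x => (subdomainsAt O x).card)
    -- The bound by `N` matters: an unbounded supremum in `ℕ` would be `0`.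
    ⟨N, by rintro _ ⟨y, rfl⟩; simpa using Finset.card_le_univ (subdomainsAt O y)⟩ x

theorem card_subdomainsAt_pos {N : ℕ} {O : Fin N → Set Plane} (hO : IsDecomposition Ω O)
    {x : Plane} (hx : x ∈ Ω) : 0 < (subdomainsAt O x).card := by
  rw [← hO.2] at hx
  obtain ⟨i, hi⟩ := mem_iUnion.1 hx
  exact Finset.card_pos.2 ⟨i, mem_subdomainsAt.2 hi⟩

theorem measurable_card_subdomainsAt {N : ℕ} {O : Fin N → Set Plane}
    (hO : IsDecomposition Ω O) : Measurable fun x => ((subdomainsAt O x).card : ℝ) := by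
  have : (fun x => ((subdomainsAt O x).card : ℝ))
      = fun x => ∑ i, (O i).indicator (fun _ => (1 : ℝ)) x := by
    ext x
    rw [sum_indicator_eq]
    simp
  rw [this]
  exact Finset.measurable_fun_sum _ fun i _ =>
    measurable_const.indicator (hO.isOpen i).measurableSet

theorem schwarzUpdate_glue_apply {N : ℕ} {O : Fin N → Set Plane} (hO : IsDecomposition Ω O)
    (τ : ℝ) (z : Plane → ℝ) (W : Fin N → Plane → ℝ) {x : Plane} (hx : x ∈ Ω) :
    schwarzUpdate τ z (fun i => glue (O i) z (W i)) x
      = (1 - τ * (subdomainsAt O x).card) * z x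
        + τ * (subdomainsAt O x).card * localAverage O W x := by
  have hk : ((subdomainsAt O x).card : ℝ) ≠ 0 := by
    exact_mod_cast (card_subdomainsAt_pos hO hx).ne'
  have h : ∀ i, (glue (O i) z (W i) - z) x = (O i).indicator (W i - z) x := by
    intro i
    by_cases hi : x ∈ O i <;> simp [glue, hi]
  rw [schwarzUpdate_eq, Pi.add_apply, Pi.smul_apply, Finset.sum_apply]
  simp only [h, sum_indicator_eq, Pi.sub_apply, smul_eq_mul, localAverage,
    Finset.sum_sub_distrib, Finset.sum_const, nsmul_eq_mul]
  field_simp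
  ring

theorem l2Norm_abs (w : Plane → ℝ) : l2Norm Ω (fun x => |w x|) = l2Norm Ω w :=
  congrArg ENNReal.toReal (eLpNorm_norm w)

/-- The error `u - y` equals `(1 - c)(u - z) + c (u - z')` a.e., and `1 ≤ c ≤ K` bounds both weights
by `K` in absolute value. This is an extrapolation rather than a convex combination, whence the loss
of `K`. -/
theorem l2Norm_sub_affine_le {u z z' y c : Plane → ℝ} {K : ℝ} (hK : 0 ≤ K) (hcm : Measurable c)
    (hc : ∀ᵐ x ∂(volume.restrict Ω), 1 ≤ c x ∧ c x ≤ K)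
    (hy : y =ᵐ[volume.restrict Ω] fun x => (1 - c x) * z x + c x * z' x)
    (hu : MemL2 Ω u) (hz : MemL2 Ω z) (hz' : MemL2 Ω z') :
    MemL2 Ω y ∧ l2Norm Ω (u - y) ≤ K * (l2Norm Ω (u - z) + l2Norm Ω (u - z')) := by
  have hym : AEStronglyMeasurable y (volume.restrict Ω) :=
    (((aestronglyMeasurable_const.sub hcm.aestronglyMeasurable).mul hz.1).add
      (hcm.aestronglyMeasurable.mul hz'.1)).congr hy.symm
  have h1 : MemL2 Ω fun x => |(u - z) x| := (MemLp.sub hu hz).abs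
  have h2 : MemL2 Ω fun x => |(u - z') x| := (MemLp.sub hu hz').abs
  have h12 : MemL2 Ω ((fun x => |(u - z) x|) + fun x => |(u - z') x|) := MemLp.add h1 h2
  have hb : ∀ᵐ x ∂(volume.restrict Ω), ‖(u - y) x‖
      ≤ K * ‖((fun x => |(u - z) x|) + fun x => |(u - z') x|) x‖ := by
    filter_upwards [hy, hc] with x hx hcx
    obtain ⟨hc1, hc2⟩ := hcx
    simp only [Pi.add_apply, Pi.sub_apply, Real.norm_eq_abs]
    rw [hx, abs_of_nonneg (by positivity : 0 ≤ |u x - z x| + |u x - z' x|),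
      show u x - ((1 - c x) * z x + c x * z' x)
        = (1 - c x) * (u x - z x) + c x * (u x - z' x) by ring]
    refine (abs_add_le _ _).trans ?_
    rw [abs_mul, abs_mul, mul_add]
    refine add_le_add (mul_le_mul_of_nonneg_right ?_ (abs_nonneg _))
      (mul_le_mul_of_nonneg_right ?_ (abs_nonneg _))
    · rw [abs_of_nonpos (by linarith)]; linarith
    · rwa [abs_of_nonneg (by linarith)]
  have hsub : MemL2 Ω (u - y) := MemLp.of_le_mul h12 (hu.1.sub hym) hb
  constructor
  · have := MemLp.sub hu hsub
    rwa [sub_sub_cancel] at this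
  have hle := eLpNorm_le_mul_eLpNorm_of_ae_le_mul hb 2
  have hle' := ENNReal.toReal_mono (ENNReal.mul_ne_top ENNReal.ofReal_ne_top h12.2.ne) hle
  rw [ENNReal.toReal_mul, ENNReal.toReal_ofReal hK] at hle'
  refine hle'.trans (mul_le_mul_of_nonneg_left ?_ hK)
  have := l2Norm_add_le h1 h2
  rwa [l2Norm_abs, l2Norm_abs] at this

theorem localAverage_estimate {N : ℕ} {O : Fin N → Set Plane} (hΩ : IsOpen Ω)
    (hO : IsDecomposition Ω O) {τ : ℝ} (hτ : 0 < τ) (hτ' : τ ≤ 1 / (maxOverlap O : ℝ))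
    {u z : Plane → ℝ} {W : Fin N → Plane → ℝ} (hu : MemL2 Ω u) (hz : MemL2 Ω z)
    (hz' : MemL2 Ω (schwarzUpdate τ z fun i => glue (O i) z (W i))) :
    MemL2 Ω (localAverage O W) ∧ l2Norm Ω (u - localAverage O W) ≤
      τ⁻¹ * (l2Norm Ω (u - z)
        + l2Norm Ω (u - schwarzUpdate τ z fun i => glue (O i) z (W i))) := by
  have hk : ∀ x ∈ Ω, (1 : ℝ) ≤ (subdomainsAt O x).card := fun x hx => by
    exact_mod_cast card_subdomainsAt_pos hO hx
  refine l2Norm_sub_affine_le (c := fun x => (τ * (subdomainsAt O x).card)⁻¹)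
    (inv_nonneg.2 hτ.le) ((measurable_card_subdomainsAt hO).const_mul τ).inv ?_ ?_ hu hz hz'
  · filter_upwards [ae_restrict_mem hΩ.measurableSet] with x hx
    have h1 := hk x hx
    have h2 : ((subdomainsAt O x).card : ℝ) ≤ maxOverlap O := by
      exact_mod_cast card_subdomainsAt_le O x
    have h3 : τ * (subdomainsAt O x).card ≤ 1 := by
      rw [le_div_iff₀ (by linarith)] at hτ'
      exact (mul_le_mul_of_nonneg_left h2 hτ.le).trans hτ'
    exact ⟨(one_le_inv₀ (by positivity)).2 h3,
      inv_anti₀ hτ (le_mul_of_one_le_right hτ.le h1)⟩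
  · filter_upwards [ae_restrict_mem hΩ.measurableSet] with x hx
    have h1 : ((subdomainsAt O x).card : ℝ) ≠ 0 := by linarith [hk x hx]
    rw [schwarzUpdate_glue_apply hO τ z W hx]
    generalize localAverage O W x = y
    field_simp
    ring

/-! ### Accumulation of the network errors. -/

theorem IsDecomposition.pos {N : ℕ} {Ω : Set Plane} {O : Fin N → Set Plane}
    (hO : IsDecomposition Ω O) (hne : Ω.Nonempty) : 0 < N := by
  obtain ⟨x, hx⟩ := hne
  rw [← hO.2] at hx
  obtain ⟨i, -⟩ := Set.mem_iUnion.1 hx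
  exact i.pos

theorem IsDecomposition.relaxation_le_one {N : ℕ} {Ω : Set Plane} {O : Fin N → Set Plane}
    (hO : IsDecomposition Ω O) (hne : Ω.Nonempty) {τ : ℝ} (hτ : τ ≤ 1 / (maxOverlap O : ℝ)) :
    τ ≤ 1 := by
  obtain ⟨x, hx⟩ := hne
  have h : (1 : ℝ) ≤ maxOverlap O := by
    exact_mod_cast (card_subdomainsAt_pos hO hx).trans_le (card_subdomainsAt_le O x)
  exact hτ.trans ((div_le_one (by linarith)).2 h)

/-- The inexact iterates stay within `ε / (1 - C)` of the exact ones. -/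
theorem h1Seminorm_iterate_sub_netIterate_le {N : ℕ} {Ω : Set Plane} {O : Fin N → Set Plane}
    (hΩ : IsOpen Ω) (hne : Ω.Nonempty) (hO : IsDecomposition Ω O) {f g u U0 : Plane → ℝ}
    (hg : MemH1 Ω g) (hu : IsWeakSolution Ω f g u) {τ : ℝ} (hτ : 0 < τ)
    (hτ' : τ ≤ 1 / (maxOverlap O : ℝ)) {un : ℕ → Plane → ℝ} {uloc : ℕ → Fin N → Plane → ℝ}
    (hun : IsSchwarzIteration Ω O f τ U0 un uloc) {W : ℕ → Fin N → Plane → ℝ}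
    (hU : ∀ n, MemH10 Ω (netIterate O τ U0 W n - g)) {ε : ℝ}
    (hε : ∀ n, LocalApproximation Ω O f ε (netIterate O τ U0 W n) (W n)) {C : ℝ}
    (hC : IsReductionFactor Ω O f u τ C) (hC1 : C < 1) (n : ℕ) :
    h1Seminorm Ω (un n - netIterate O τ U0 W n) ≤ ε / (1 - C) := by
  have hN := hO.pos hne
  -- Nonnegativity follows because some local seminorm is bounded by `ε / N` with `N > 0`.
  have hε0 : 0 ≤ ε := by
    obtain ⟨-, ut, -, h⟩ := hε 0 ⟨0, hN⟩
    have hN' : (0 : ℝ) < N := by exact_mod_cast hN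
    have := mul_nonneg ((Real.sqrt_nonneg _).trans h) hN'.le
    rwa [div_mul_cancel₀ _ hN'.ne'] at this
  have hτ1 := hO.relaxation_le_one hne hτ'
  have hC2 : 0 < 1 - C := by linarith
  have hU1 : ∀ n, MemH1 Ω (netIterate O τ U0 W n) := fun n => by
    simpa using (hU n).1.add hg
  have hun0 : ∀ n, MemH10 Ω (un n - g) := fun n => hun.sub_memH10 hΩ hO (hU 0) n
  have hun1 : ∀ n, MemH1 Ω (un n) := fun n => by simpa using (hun0 n).1.add hg
  have hd : ∀ n, MemH10 Ω (un n - netIterate O τ U0 W n) := fun n => by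
    simpa using (hun0 n).sub hΩ (hU n)
  induction n with
  | zero =>
    have h0 : un 0 - netIterate O τ U0 W 0 = (0 : ℝ) • g := by
      rw [hun.1, zero_smul]; exact sub_self _
    rw [h0, h1Seminorm_eq_norm, gradL2_const_smul hΩ hg, zero_smul, norm_zero]
    positivity
  | succ n ih =>
    obtain ⟨ut, hut, hle⟩ := exists_local_h1Seminorm_sub_glue_le hΩ hO hN hτ (hU1 n)
      (hU1 (n + 1)) (hε n)
    have h1 := hC.h1Seminorm_update_sub_le hΩ hO hu (hd n) (hun.2 n).1 hut
    have hexact : MemH1 Ω (schwarzUpdate τ (netIterate O τ U0 W n) ut) := by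
      simpa using (schwarzUpdate_sub_memH10 hΩ hO τ hut).1.add (hU1 n)
    rw [← (hun.2 n).2] at h1
    change h1Seminorm Ω (_ - netIterate O τ U0 W (n + 1)) ≤ _ at hle
    have hsplit : un (n + 1) - netIterate O τ U0 W (n + 1)
        = (un (n + 1) - schwarzUpdate τ (netIterate O τ U0 W n) ut)
          + (schwarzUpdate τ (netIterate O τ U0 W n) ut - netIterate O τ U0 W (n + 1)) :=
      (sub_add_sub_cancel _ _ _).symm
    rw [hsplit]
    simp only [h1Seminorm_eq_norm] at h1 hle ih ⊢
    rw [gradL2_add hΩ ((hun1 _).sub hexact) (hexact.sub (hU1 _))]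
    have h2 := mul_le_mul_of_nonneg_left ih hC.1
    have h3 : τ * ε ≤ ε := mul_le_of_le_one_left hε0 hτ1
    -- The bound is the fixed point of `d ↦ C d + ε`.
    have h4 : C * (ε / (1 - C)) + ε = ε / (1 - C) := by field_simp; ring
    refine (norm_add_le _ _).trans ?_
    linarith

end Schwarz

end

/-! ### The main theorem. -/

theorem theorem3 {N : ℕ} (Ω : Set Schwarz.Plane) (O : Fin N → Set Schwarz.Plane)
    (hΩ_open : IsOpen Ω) (hΩ_bdd : Bornology.IsBounded Ω) (hΩ_ne : Ω.Nonempty)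
    (hO : Schwarz.IsDecomposition Ω O)
    -- the model problem
    (f g u : Schwarz.Plane → ℝ) (hf : Schwarz.MemL2 Ω f) (hg : Schwarz.MemH1 Ω g)
    (hu : Schwarz.IsWeakSolution Ω f g u)
    -- the relaxation parameter
    (τ : ℝ) (hτ_pos : 0 < τ) (hτ_le : τ ≤ 1 / (Schwarz.maxOverlap O : ℝ))
    -- the two assumptions on the decomposition
    (C0 : ℝ) (hC0 : Schwarz.StableDecomposition Ω O C0)
    (M : Matrix (Fin N) (Fin N) ℝ) (hM : Schwarz.StrengthenedCauchySchwarz Ω O M)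
    -- the iterates `u^{(n)}` in the Hilbert space
    (U0 : Schwarz.Plane → ℝ) (un : ℕ → Schwarz.Plane → ℝ)
    (uloc : ℕ → Fin N → Schwarz.Plane → ℝ)
    (hun : Schwarz.IsSchwarzIteration Ω O f τ U0 un uloc)
    -- the local networks `U_i(x; θ)` and their parameters `θ_i^{(n+1)} = θ n i`
    {Θ : Fin N → Type*} (net : (i : Fin N) → Θ i → Schwarz.Plane → ℝ)
    (θ : ℕ → (i : Fin N) → Θ i)
    -- the iterates `U^{(n)}` are conforming, with the boundary values `g`
    (hU : ∀ n, Schwarz.MemH10 Ω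
      (Schwarz.netIterate O τ U0 (fun m i => net i (θ m i)) n - g))
    -- the assumption on the network approximation
    (ε : ℝ)
    (hε : ∀ n, Schwarz.LocalApproximation Ω O f ε
      (Schwarz.netIterate O τ U0 (fun m i => net i (θ m i)) n) (fun i => net i (θ n i))) :
    (∃ Cp, Schwarz.IsPoincareConstant Ω Cp) ∧
    Schwarz.IsReductionFactor Ω O f u τ (Schwarz.theoreticalFactor C0 M τ) ∧
    ∀ Cp C1 : ℝ, Schwarz.IsPoincareConstant Ω Cp →
      Schwarz.IsReductionFactor Ω O f u τ C1 → C1 < 1 → ∀ n : ℕ,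
        Schwarz.MemL2 Ω (Schwarz.localAverage O fun i => net i (θ n i)) ∧
        Schwarz.l2Norm Ω (u - Schwarz.localAverage O fun i => net i (θ n i)) ≤
          Cp / τ * (Schwarz.h1Seminorm Ω (u - un n) + Schwarz.h1Seminorm Ω (u - un (n + 1)) +
            2 / (1 - C1) * ε) := by
  refine ⟨Schwarz.exists_isPoincareConstant hΩ_open hΩ_bdd,
    Schwarz.isReductionFactor_theoreticalFactor hΩ_open hO hu hτ_pos.le hC0 hM,
    fun Cp C1 hCp hC1 hlt n => ?_⟩
  set U := Schwarz.netIterate O τ U0 (fun m i => net i (θ m i)) with hUdef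
  have hU1 : ∀ n, Schwarz.MemH1 Ω (U n) := fun n => by simpa using (hU n).1.add hg
  have hun1 : ∀ n, Schwarz.MemH1 Ω (un n) := fun n => by
    simpa using (hun.sub_memH10 hΩ_open hO (hU 0) n).1.add hg
  have huU : ∀ n, Schwarz.MemH10 Ω (u - U n) := fun n => by
    simpa using hu.2.1.sub hΩ_open (hU n)
  obtain ⟨hmem, hle⟩ := Schwarz.localAverage_estimate (W := fun i => net i (θ n i)) hΩ_open hO
    hτ_pos hτ_le hu.1.1 (hU1 n).1 (hU1 (n + 1)).1
  refine ⟨hmem, hle.trans ?_⟩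
  -- Poincaré applies because `u` and `U n` have the same boundary values; the `H¹` error is then
  -- split at the exact iterate `un n`.
  have herr : ∀ n, Schwarz.l2Norm Ω (u - U n) ≤
      Cp * (Schwarz.h1Seminorm Ω (u - un n) + ε / (1 - C1)) := by
    intro n
    refine (hCp.2 _ (huU n)).trans (mul_le_mul_of_nonneg_left ?_ hCp.1)
    have h := Schwarz.h1Seminorm_iterate_sub_netIterate_le hΩ_open hΩ_ne hO hg hu hτ_pos hτ_le
      hun hU hε hC1 hlt n
    rw [← hUdef] at h
    simp only [Schwarz.h1Seminorm_eq_norm] at h ⊢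
    rw [← sub_add_sub_cancel u (un n) (U n),
      Schwarz.gradL2_add hΩ_open (hu.1.sub (hun1 n)) ((hun1 n).sub (hU1 n))]
    exact (norm_add_le _ _).trans (by linarith)
  have h1 := add_le_add (herr n) (herr (n + 1))
  refine (mul_le_mul_of_nonneg_left h1 (inv_nonneg.2 hτ_pos.le)).trans (le_of_eq ?_)
  ring
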